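/- **Theorem B.** Let $M$ be a compact smooth manifold without boundary, of dimension at least $1$, with a smooth Riemannian metric, and let $m$ be its normalized Riemannian volume (Lebesgue measure). Let $0<\alpha\le 1$, let $f_1,\dots,f_d:M\to M$ be $C^{1+\alpha}$ local diffeomorphisms (that is, $C^1$ local diffeomorphisms whose derivative is $\alpha$-Hölder continuous in charts), and let $\Gamma$ be the semigroup generated by $f_1,\dots,f_d$ under composition. Assume that 1. (exactness) for every nonempty open set $B\subset M$ there is a sequence $(g_k)_{k\in\mathbb N}$ in $\Gamma$ such that $m\bigl(M\setminus\bigcup_{k} g_k(B)\bigr)=0$; 2. (non-uniform expansion along an orbital branch) there is a sequence $\omega=\omega_1\omega_2\dots\in\{1,\dots,d\}^{\mathbb N}$ such that, with $f_\omega^0=\mathrm{id}$ and $f_\omega^i=f_{\omega_i}\circ\dots\circ f_{\omega_1}$, for $m$-almost every $x\in M$ $$\limsup_{N\to\infty}\frac1N\sum_{i=0}^{N-1}\log\bigl\|Df_{\omega_{i+1}}(f_\omega^i(x))^{-1}\bigr\|<0,$$ where $\|\cdot\|$ is the operator norm with respect to the Riemannian metric. Then the action of $\Gamma$ is ergodic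 with respect to Lebesgue measure: every Lebesgue measurable set $A\subset M$ with $g(A)\subset A$ for all $g\in\Gamma$ satisfies $m(A)\in\{0,1\}$. -/

import Mathlib

open Set Filter MeasureTheory Bundle
open scoped Manifold ContDiff NNReal ENNReal

namespace SemigroupErgodicity

noncomputable section

section RiemannianVolume

variable (n : ℕ) {M : Type*} [TopologicalSpace M] [ChartedSpace (EuclideanSpace ℝ (Fin n)) M]

/-- The `i`-th coordinate vector field `∂ᵢ` of the preferred chart `φ` at `p`, at the point
`φ⁻¹ y`. -/
def coordVector (p : M) (y : EuclideanSpace ℝ (Fin n)) (i : Fin n) :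
    TangentSpace (𝓡 n) ((chartAt (EuclideanSpace ℝ (Fin n)) p).symm y) :=
  mfderiv (𝓡 n) (𝓡 n) (chartAt (EuclideanSpace ℝ (Fin n)) p).symm y
    (EuclideanSpace.single i (1 : ℝ))

variable [RiemannianBundle (fun x : M ↦ TangentSpace (𝓡 n) x)]

/-- The Gram matrix `g_{ij} = ⟨∂ᵢ, ∂ⱼ⟩` of the Riemannian metric in the preferred chart at `p`. -/
def gramMatrix (p : M) (y : EuclideanSpace ℝ (Fin n)) : Matrix (Fin n) (Fin n) ℝ :=
  Matrix.of fun i j ↦ inner ℝ (coordVector n p y i) (coordVector n p y j)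

variable [MeasurableSpace M]

/-- The measure on the domain of the preferred chart `φ` at `p` which is given in this chart by
`√(det g_{ij}) dy₁ … dyₙ`, extended by zero. -/
def chartVolume (p : M) : Measure M :=
  Measure.map (chartAt (EuclideanSpace ℝ (Fin n)) p).symm
    ((volume.restrict (chartAt (EuclideanSpace ℝ (Fin n)) p).target).withDensity
      fun y ↦ ENNReal.ofReal (Real.sqrt (gramMatrix n p y).det))

variable (M)

/-- The Riemannian volume (Lebesgue measure) of `M`. The measures `chartVolume n p` agree on the
overlaps of their chart domains, and their supremum is the measure which restricts to each of
them. -/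
def riemannianVolume : Measure M :=
  ⨆ p : M, chartVolume n p

/-- The normalized Lebesgue measure of `M`. -/
def lebesgue : Measure M :=
  (riemannianVolume n M univ)⁻¹ • riemannianVolume n M

end RiemannianVolume

section Maps

variable (n : ℕ) {M : Type*} [TopologicalSpace M] [ChartedSpace (EuclideanSpace ℝ (Fin n)) M]

/-- `f` is a `C^{1+α}` local diffeomorphism: a `C^1` local diffeomorphism whose derivative, read in
charts, is locally `α`-Hölder continuous. -/
structure IsC1HolderLocalDiffeo (α : ℝ≥0) (f : M → M) : Prop where
  isLocalDiffeomorph : IsLocalDiffeomorph (𝓡 n) (𝓡 n) 1 f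
  holder : ∀ p : M, ∃ U ∈ nhds (chartAt (EuclideanSpace ℝ (Fin n)) p p), ∃ C : ℝ≥0,
    HolderOnWith C α
      (fderiv ℝ (chartAt (EuclideanSpace ℝ (Fin n)) (f p) ∘ f ∘
        (chartAt (EuclideanSpace ℝ (Fin n)) p).symm)) U

/-- `‖Df(x)⁻¹‖`, the operator norm for the Riemannian norms on `T_{f x} M` and `T_x M`. -/
def normInvDeriv [RiemannianBundle (fun x : M ↦ TangentSpace (𝓡 n) x)]
    (f : M → M) (x : M) : ℝ :=
  ‖(mfderiv (𝓡 n) (𝓡 n) f x).inverse‖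

end Maps

section Actions

variable {M : Type*} {d : ℕ}

/-- The semigroup (under composition) generated by `f₁, …, f_d`. -/
def generatedSemigroup (f : Fin d → M → M) : Subsemigroup (Function.End M) :=
  Subsemigroup.closure (range f)

/-- The orbital branch `f_w^k = f_{w_k} ∘ ⋯ ∘ f_{w_1}`; the letter `w_{i+1}` is `w i`. -/
def orbitalBranch (f : Fin d → M → M) (w : ℕ → Fin d) : ℕ → M → M
  | 0 => id
  | k + 1 => f (w k) ∘ orbitalBranch f w k

/-- Every nonempty open set is spread over `M`, up to a `m`-null set, by countably many elements
of the semigroup. -/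
def IsExactAction [TopologicalSpace M] [MeasurableSpace M] (m : Measure M)
    (Γ : Subsemigroup (Function.End M)) : Prop :=
  ∀ B : Set M, IsOpen B → B.Nonempty →
    ∃ g : ℕ → M → M, (∀ k, (g k : Function.End M) ∈ Γ) ∧ m (⋃ k, g k '' B)ᶜ = 0

/-- Forward invariant sets of the action. -/
def IsInvariantSet (Γ : Subsemigroup (Function.End M)) (A : Set M) : Prop :=
  ∀ g : M → M, (g : Function.End M) ∈ Γ → g '' A ⊆ A

/-- Ergodicity of the action with respect to the probability measure `m`; measurability is with
respect to the completion of `m`. -/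
def IsErgodicAction [MeasurableSpace M] (m : Measure M)
    (Γ : Subsemigroup (Function.End M)) : Prop :=
  ∀ A : Set M, NullMeasurableSet A m → IsInvariantSet Γ A → m A = 0 ∨ m A = 1

/-- The maps `f₁, …, f_d` are non-uniformly expanding along a single orbital branch. -/
def IsNonUniformlyExpanding (n : ℕ) [TopologicalSpace M]
    [ChartedSpace (EuclideanSpace ℝ (Fin n)) M]
    [RiemannianBundle (fun x : M ↦ TangentSpace (𝓡 n) x)] [MeasurableSpace M]
    (m : Measure M) (f : Fin d → M → M) : Prop :=
  ∃ w : ℕ → Fin d, ∀ᵐ x ∂m,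
    limsup (fun N : ℕ ↦ (((1 / (N : ℝ)) * ∑ i ∈ Finset.range N,
      Real.log (normInvDeriv n (f (w i)) (orbitalBranch f w i x)) : ℝ) : EReal)) atTop < 0

end Actions

end

end SemigroupErgodicity

/-! Let `A` be forward invariant with positive measure. Negativity of the limsup gives almost every
point infinitely many hyperbolic times `N`, at which every final block of the orbit segment expands
at a definite rate (`frequently_isHyperbolicTime`). At such a time `orbitalBranch f w N` sends a
Bowen ball onto a set containing a ball of fixed radius (`eball_subset_image_bowenBall`). Its
distortion there is bounded independently of `N`, since Hölder oscillations along a backward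
contracting orbit sum to a geometric series (`hasDistortionOn_bowenBall`).

Suppose no nonempty open set lies in `A` modulo a null set. By compactness all balls of radius `δ`
meet the complement of `A` in measure at least some `b > 0`. Points that leave `A` under a forward
iterate were not in `A`, so pulling back shows that each Bowen ball has a fixed proportion of its
measure outside `A`. A Vitali covering by Bowen balls inside a tight open neighbourhood of `A` then
forces measure zero (`exists_isOpen_of_frequently_isHyperbolicTime`). Bowen balls need not be round;
their engulfing property replaces the doubling property of metric balls. Hence `A` contains a
nonempty open set modulo a null set, and exactness spreads it over `M`, because the maps preserve
null sets (`measure_compl_eq_zero_of_isExactAction`).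

This argument takes place in a compact metric space. Two uniform facts feed it from the manifold:
inverse branches expand distances by at most `exp ε * normInvDeriv`
(`exists_forall_hasInverseBranchBound`), and distortion on balls of radius `s` is at most `C * s ^
α` (`exists_forall_hasDistortionOn_eball`). -/

namespace SemigroupErgodicity

open scoped Topology

/-! ### Hyperbolic times of real sequences. -/

section HyperbolicTimes

/-- `N` is a hyperbolic time of the sequence `a`, with rate `c`: every final block of
`a 0, …, a (N - 1)` has average at most `-c`. -/
def IsHyperbolicTime (c : ℝ) (a : ℕ → ℝ) (N : ℕ) : Prop :=
  ∀ k ≤ N, ∑ i ∈ Finset.Ico k N, a i ≤ -c * ((N : ℝ) - k)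

/-- The sums corrected by `c * N` tend to `-∞`, so they reach a new strict minimum infinitely often,
and a time of record low is a hyperbolic time. This avoids the density count of Pliss' lemma. -/
theorem frequently_isHyperbolicTime {c : ℝ} (hc : 0 < c) {a : ℕ → ℝ}
    (ha : ∀ᶠ N : ℕ in atTop, ∑ i ∈ Finset.range N, a i ≤ -(2 * c) * N) :
    ∃ᶠ N in atTop, IsHyperbolicTime c a N := by
  have htend : Tendsto (fun N : ℕ ↦ ∑ i ∈ Finset.range N, a i + c * N) atTop atBot := by
    have h1 : Tendsto (fun N : ℕ ↦ -c * (N : ℝ)) atTop atBot :=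
      tendsto_natCast_atTop_atTop.const_mul_atTop_of_neg (by linarith)
    refine tendsto_atBot_mono' _ ?_ h1
    filter_upwards [ha] with N hN
    linarith
  refine (frequently_low_scores htend).mono fun N hN k hk ↦ ?_
  rcases hk.eq_or_lt with rfl | hk'
  · simp
  · have := hN k hk'
    rw [Finset.sum_Ico_eq_sub _ hk]
    linarith

/-- The rate is taken of the form `1 / (j + 1)` so that the points can later be split into countably
many classes. -/
theorem exists_eventually_sum_le_of_limsup_neg {a : ℕ → ℝ}
    (h : limsup (fun N : ℕ ↦ (((1 / (N : ℝ)) * ∑ i ∈ Finset.range N, a i : ℝ) : EReal)) atTop < 0) :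
    ∃ j : ℕ, ∀ᶠ N : ℕ in atTop, ∑ i ∈ Finset.range N, a i ≤ -(2 * (1 / ((j : ℝ) + 1))) * N := by
  obtain ⟨b, hb, hb0⟩ := EReal.lt_iff_exists_real_btwn.1 h
  have hb0' : b < 0 := by exact_mod_cast hb0
  obtain ⟨j, hj⟩ := exists_nat_one_div_lt (show 0 < -b / 2 by linarith)
  refine ⟨j, ?_⟩
  filter_upwards [eventually_lt_of_limsup_lt hb, eventually_gt_atTop 0] with N hN hN0
  have hN' : (0 : ℝ) < N := by exact_mod_cast hN0
  have h2 : (1 / (N : ℝ)) * ∑ i ∈ Finset.range N, a i < b := by exact_mod_cast hN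
  rw [one_div, inv_mul_lt_iff₀ hN'] at h2
  nlinarith

end HyperbolicTimes

/-! ### Bowen balls and backward orbits. -/

section BowenBalls

variable {X : Type*} [EMetricSpace X]

/-- The Bowen ball of the sequence of maps `F`: the points whose first `N + 1` images stay within
distance `r` of those of `x`. -/
def bowenBall (F : ℕ → X → X) (N : ℕ) (x : X) (r : ℝ≥0∞) : Set X :=
  {y | ∀ k ≤ N, edist (F k y) (F k x) < r}

theorem mem_bowenBall_self (F : ℕ → X → X) (N : ℕ) (x : X) {r : ℝ≥0∞} (hr : 0 < r) :
    x ∈ bowenBall F N x r := fun k _ ↦ by simpa using hr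

theorem isOpen_bowenBall {F : ℕ → X → X} (hF : ∀ k, Continuous (F k)) (N : ℕ) (x : X)
    (r : ℝ≥0∞) : IsOpen (bowenBall F N x r) := by
  have : bowenBall F N x r = ⋂ k ∈ Finset.range (N + 1), F k ⁻¹' Metric.eball (F k x) r := by
    ext y
    simp [bowenBall]
  rw [this]
  exact isOpen_biInter_finset fun k _ ↦ Metric.isOpen_eball.preimage (hF k)

/-- Engulfing property of Bowen balls. -/
theorem bowenBall_subset_of_inter_nonempty {F : ℕ → X → X} {N N' : ℕ} (hN : N ≤ N') {x x' : X}
    {r : ℝ≥0∞} (h : (bowenBall F N' x' r ∩ bowenBall F N x r).Nonempty) :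
    bowenBall F N' x' r ⊆ bowenBall F N x (3 * r) := by
  obtain ⟨z, hz', hz⟩ := h
  intro y hy k hk
  calc edist (F k y) (F k x)
      ≤ edist (F k y) (F k x') + edist (F k x') (F k z) + edist (F k z) (F k x) :=
        edist_triangle4 _ _ _ _
    _ < r + r + r := by
        refine ENNReal.add_lt_add (ENNReal.add_lt_add (hy k (hk.trans hN)) ?_) (hz k hk)
        rw [edist_comm]
        exact hz' k (hk.trans hN)
    _ = 3 * r := by ring

/-- Backward contraction along an orbit segment which is expanding at each step. -/
theorem edist_le_exp_sum_mul {F : ℕ → X → X} {x y : X} {N : ℕ} {a : ℕ → ℝ}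
    (h : ∀ k < N, edist (F k y) (F k x) ≤
      ENNReal.ofReal (Real.exp (a k)) * edist (F (k + 1) y) (F (k + 1) x)) :
    ∀ k ≤ N, edist (F k y) (F k x) ≤
      ENNReal.ofReal (Real.exp (∑ i ∈ Finset.Ico k N, a i)) * edist (F N y) (F N x) := by
  intro k hk
  induction hk using Nat.decreasingInduction with
  | self => simp
  | of_succ k hk ih =>
    refine (h k hk).trans ?_
    rw [Finset.sum_eq_sum_Ico_succ_bot hk, Real.exp_add, ENNReal.ofReal_mul (Real.exp_pos _).le,
      mul_assoc]
    gcongr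

/-- Pulling back a point along an orbit segment. -/
theorem exists_backward_orbit {T : ℕ → X → X} {p : ℕ → X} {N : ℕ} {a : ℕ → ℝ}
    {r : ℝ≥0∞} (ha : ∀ k ≤ N, ∑ i ∈ Finset.Ico k N, a i ≤ 0)
    (hT : ∀ k < N, ∀ q, edist q (p (k + 1)) < r → ∃ y, T k y = q ∧
      edist y (p k) ≤ ENNReal.ofReal (Real.exp (a k)) * edist q (p (k + 1)))
    {q : X} (hq : edist q (p N) < r) :
    ∃ z : ℕ → X, z N = q ∧ (∀ k < N, T k (z k) = z (k + 1)) ∧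
      ∀ k ≤ N, edist (z k) (p k) ≤ edist q (p N) := by
  -- The induction runs down from `N` and must carry the exponential bound: it alone keeps each new
  -- point within `r`, where the next inverse branch exists.
  suffices H : ∀ k ≤ N, ∃ z : ℕ → X, z N = q ∧ (∀ i, k ≤ i → i < N → T i (z i) = z (i + 1)) ∧
      ∀ i, k ≤ i → i ≤ N → edist (z i) (p i) ≤
        ENNReal.ofReal (Real.exp (∑ j ∈ Finset.Ico i N, a j)) * edist q (p N) by
    obtain ⟨z, hz, hzT, hzd⟩ := H 0 (Nat.zero_le _)
    refine ⟨z, hz, fun k hk ↦ hzT k (Nat.zero_le _) hk, fun k hk ↦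
      (hzd k (Nat.zero_le _) hk).trans ?_⟩
    refine (mul_le_mul_left (ENNReal.ofReal_le_one.2 (Real.exp_le_one_iff.2 (ha k hk))) _).trans ?_
    rw [one_mul]
  intro k hk
  induction hk using Nat.decreasingInduction with
  | self =>
    refine ⟨fun _ ↦ q, rfl, fun i hi hi' ↦ absurd hi hi'.not_ge, fun i hi hi' ↦ ?_⟩
    obtain rfl := le_antisymm hi' hi
    simp
  | of_succ k hk ih =>
    obtain ⟨z, hz, hzT, hzd⟩ := ih
    have h1 := hzd (k + 1) le_rfl hk
    have h2 : edist (z (k + 1)) (p (k + 1)) < r := by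
      refine (h1.trans ((mul_le_mul_left
        (ENNReal.ofReal_le_one.2 (Real.exp_le_one_iff.2 (ha (k + 1) hk))) _).trans ?_)).trans_lt hq
      rw [one_mul]
    obtain ⟨y, hy, hyd⟩ := hT k hk _ h2
    refine ⟨Function.update z k y, ?_, fun i hi hi' ↦ ?_, fun i hi hi' ↦ ?_⟩
    · rw [Function.update_of_ne hk.ne', hz]
    · rcases hi.eq_or_lt with rfl | hlt
      · rw [Function.update_self, Function.update_of_ne (by lia), hy]
      · rw [Function.update_of_ne hlt.ne', Function.update_of_ne (by lia)]
        exact hzT i hlt hi'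
    · rcases hi.eq_or_lt with rfl | hlt
      · rw [Function.update_self, Finset.sum_eq_sum_Ico_succ_bot hk, Real.exp_add,
          ENNReal.ofReal_mul (Real.exp_pos _).le, mul_assoc]
        exact hyd.trans (by gcongr)
      · rw [Function.update_of_ne hlt.ne']
        exact hzd i hlt hi'

end BowenBalls

/-! ### Calculus of measure distortion. -/

section Distortion

variable {X : Type*} [MeasurableSpace X]

/-- `T` multiplies the measure of the measurable subsets of `S` by a constant, up to a factor
`exp κ`. -/
def HasDistortionOn (m : Measure X) (T : X → X) (S : Set X) (κ : ℝ) : Prop :=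
  ∃ J : ℝ≥0∞, J ≠ 0 ∧ J ≠ ⊤ ∧ ∀ E ⊆ S, MeasurableSet E → MeasurableSet (T '' E) ∧
    m (T '' E) ≤ ENNReal.ofReal (Real.exp κ) * (J * m E) ∧
    J * m E ≤ ENNReal.ofReal (Real.exp κ) * m (T '' E)

variable {m : Measure X}

theorem hasDistortionOn_id (S : Set X) : HasDistortionOn m id S 0 :=
  ⟨1, one_ne_zero, ENNReal.one_ne_top, fun E _ hE ↦ by simp [hE]⟩

theorem HasDistortionOn.mono {T : X → X} {S : Set X} {κ κ' : ℝ} (h : HasDistortionOn m T S κ)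
    (hκ : κ ≤ κ') : HasDistortionOn m T S κ' := by
  obtain ⟨J, h0, h1, H⟩ := h
  refine ⟨J, h0, h1, fun E hE hEm ↦ ⟨(H E hE hEm).1, (H E hE hEm).2.1.trans ?_,
    (H E hE hEm).2.2.trans ?_⟩⟩ <;> gcongr

theorem HasDistortionOn.comp {T T' : X → X} {S S' : Set X} {κ κ' : ℝ}
    (h' : HasDistortionOn m T' S' κ') (h : HasDistortionOn m T S κ) (hS : MapsTo T S S') :
    HasDistortionOn m (T' ∘ T) S (κ + κ') := by
  obtain ⟨J, h0, h1, H⟩ := h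
  obtain ⟨J', h0', h1', H'⟩ := h'
  refine ⟨J' * J, mul_ne_zero h0' h0, ENNReal.mul_ne_top h1' h1, fun E hE hEm ↦ ?_⟩
  obtain ⟨a1, a2, a3⟩ := H E hE hEm
  obtain ⟨b1, b2, b3⟩ := H' (T '' E) ((image_mono hE).trans hS.image_subset) a1
  rw [image_comp, Real.exp_add, ENNReal.ofReal_mul (Real.exp_pos _).le]
  refine ⟨b1, b2.trans ?_, ?_⟩
  · calc ENNReal.ofReal (Real.exp κ') * (J' * m (T '' E))
        ≤ ENNReal.ofReal (Real.exp κ') * (J' * (ENNReal.ofReal (Real.exp κ) * (J * m E))) := by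
          gcongr
      _ = _ := by ring
  · calc J' * J * m E = J' * (J * m E) := by ring
      _ ≤ J' * (ENNReal.ofReal (Real.exp κ) * m (T '' E)) := by gcongr
      _ = ENNReal.ofReal (Real.exp κ) * (J' * m (T '' E)) := by ring
      _ ≤ ENNReal.ofReal (Real.exp κ) * (ENNReal.ofReal (Real.exp κ') * m (T' '' (T '' E))) := by
          gcongr
      _ = _ := by ring

/-- Distortion on `E` and on `S` involves the same `J`, which cancels; each comparison costs one
factor `exp κ`. -/
theorem HasDistortionOn.measure_mul_le {T : X → X} {S E : Set X} {κ : ℝ}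
    (h : HasDistortionOn m T S κ) (hS : MeasurableSet S) (hE : MeasurableSet E) (hES : E ⊆ S) :
    m (T '' E) * m S ≤ ENNReal.ofReal (Real.exp (2 * κ)) * m univ * m E := by
  obtain ⟨J, h0, h1, H⟩ := h
  have a := (H E hES hE).2.1
  have b := (H S Subset.rfl hS).2.2
  refine (ENNReal.mul_le_mul_iff_right h0 h1).1 ?_
  calc J * (m (T '' E) * m S) = m (T '' E) * (J * m S) := by ring
    _ ≤ (ENNReal.ofReal (Real.exp κ) * (J * m E)) *
        (ENNReal.ofReal (Real.exp κ) * m univ) := by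
        refine mul_le_mul' a (b.trans ?_)
        gcongr
        exact subset_univ _
    _ = _ := by
        rw [two_mul, Real.exp_add, ENNReal.ofReal_mul (Real.exp_pos _).le]
        ring

theorem HasDistortionOn.measure_image_eq_zero {T : X → X} {S E : Set X} {κ : ℝ}
    (h : HasDistortionOn m T S κ) (hS : MeasurableSet S) (hES : E ⊆ S) (hE : m E = 0) :
    m (T '' E) = 0 := by
  obtain ⟨J, h0, h1, H⟩ := h
  -- `E` need not be measurable, so a measurable null hull inside `S` takes its place.
  have a := (H (toMeasurable m E ∩ S) inter_subset_right
    ((measurableSet_toMeasurable m E).inter hS)).2.1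
  have h0 : m (toMeasurable m E ∩ S) = 0 :=
    measure_mono_null inter_subset_left (by rwa [measure_toMeasurable])
  rw [h0] at a
  refine measure_mono_null (image_mono (subset_inter (subset_toMeasurable m E) hES)) ?_
  simpa using a

end Distortion

/-! ### Expansion and bounded distortion at hyperbolic times. -/

section Expanding

variable {X : Type*} [EMetricSpace X]

/-- Near `p`, the map `T` has an inverse branch sending `T p` to `p` which increases the distance
to the base point at most by the factor `K`. -/
structure HasInverseBranchBound (T : X → X) (p : X) (K : ℝ) (r : ℝ≥0∞) : Prop where
  edist_le : ∀ y, edist y p < r → edist y p ≤ ENNReal.ofReal K * edist (T y) (T p)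
  exists_preimage : ∀ q, edist q (T p) < r →
    ∃ y, T y = q ∧ edist y p ≤ ENNReal.ofReal K * edist q (T p)

theorem HasInverseBranchBound.mono {T : X → X} {p : X} {K K' : ℝ} {r r' : ℝ≥0∞}
    (h : HasInverseBranchBound T p K r) (hK : K ≤ K') (hr : r' ≤ r) :
    HasInverseBranchBound T p K' r' where
  edist_le y hy := (h.edist_le y (hy.trans_le hr)).trans (by gcongr)
  exists_preimage q hq := by
    obtain ⟨y, hy, hyd⟩ := h.exists_preimage q (hq.trans_le hr)
    exact ⟨y, hy, hyd.trans (by gcongr)⟩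

variable {d : ℕ} {f : Fin d → X → X} {w : ℕ → Fin d} {ν : Fin d → X → ℝ} {c : ℝ} {x : X} {N : ℕ}
  {r : ℝ≥0∞}

/-- Inverse branches are controlled only up to a factor `exp (c / 2)`; paying `c / 2` at each step
leaves half of the rate `c`. -/
theorem sum_add_log_le {Y : Type*} {f : Fin d → Y → Y} {ν : Fin d → Y → ℝ} {x : Y}
    (hN : IsHyperbolicTime c
      (fun i ↦ Real.log (ν (w i) (orbitalBranch f w i x))) N) {k : ℕ} (hk : k ≤ N) :
    ∑ i ∈ Finset.Ico k N, (c / 2 + Real.log (ν (w i) (orbitalBranch f w i x))) ≤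
      -(c / 2) * ((N : ℝ) - k) := by
  have := hN k hk
  rw [Finset.sum_add_distrib, Finset.sum_const, Nat.card_Ico, nsmul_eq_mul, Nat.cast_sub hk]
  linarith

theorem exp_half_add_log {Y : Type*} {ν : Fin d → Y → ℝ} (hν : ∀ i p, 0 < ν i p) (i : Fin d)
    (p : Y) :
    Real.exp (c / 2 + Real.log (ν i p)) = Real.exp (c / 2) * ν i p := by
  rw [Real.exp_add, Real.exp_log (hν i p)]

theorem edist_orbitalBranch_le (hν : ∀ i p, 0 < ν i p)
    (hf : ∀ i p, HasInverseBranchBound (f i) p (Real.exp (c / 2) * ν i p) r)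
    (hN : IsHyperbolicTime c (fun i ↦ Real.log (ν (w i) (orbitalBranch f w i x))) N) {y : X}
    (hy : y ∈ bowenBall (orbitalBranch f w) N x r) {k : ℕ} (hk : k ≤ N) :
    edist (orbitalBranch f w k y) (orbitalBranch f w k x) ≤
      ENNReal.ofReal (Real.exp (-(c / 2) * ((N : ℝ) - k))) *
        edist (orbitalBranch f w N y) (orbitalBranch f w N x) := by
  refine (edist_le_exp_sum_mul (F := orbitalBranch f w)
    (a := fun i ↦ c / 2 + Real.log (ν (w i) (orbitalBranch f w i x))) (fun i hi ↦ ?_) k hk).trans ?_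
  · rw [exp_half_add_log hν]
    exact (hf (w i) _).edist_le _ (hy i hi.le)
  · gcongr
    exact sum_add_log_le hN hk

/-- The backward orbit of a point never gets farther from the orbit of `x` than it was at time `N`,
so its starting point lies in the Bowen ball of the same radius. -/
theorem eball_subset_image_bowenBall (hc : 0 < c) (hν : ∀ i p, 0 < ν i p)
    (hf : ∀ i p, HasInverseBranchBound (f i) p (Real.exp (c / 2) * ν i p) r)
    (hN : IsHyperbolicTime c (fun i ↦ Real.log (ν (w i) (orbitalBranch f w i x))) N)
    {ρ : ℝ≥0∞} (hρ : ρ ≤ r) :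
    Metric.eball (orbitalBranch f w N x) ρ ⊆
      orbitalBranch f w N '' bowenBall (orbitalBranch f w) N x ρ := by
  intro q hq
  have hq' : edist q (orbitalBranch f w N x) < ρ := hq
  obtain ⟨z, hz, hzT, hzd⟩ := exists_backward_orbit (T := fun k ↦ f (w k))
    (p := fun k ↦ orbitalBranch f w k x) (N := N) (r := r)
    (a := fun i ↦ c / 2 + Real.log (ν (w i) (orbitalBranch f w i x))) (fun k hk ↦ by
      refine (sum_add_log_le hN hk).trans ?_
      have : (k : ℝ) ≤ N := by exact_mod_cast hk
      nlinarith)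
    (fun k _ q hq ↦ by
      rw [exp_half_add_log hν]
      exact (hf (w k) _).exists_preimage q hq) (hq'.trans_le hρ)
  have horb : ∀ k ≤ N, orbitalBranch f w k (z 0) = z k := by
    intro k
    induction k with
    | zero => intro _; rfl
    | succ k ih =>
      intro hk
      rw [← hzT k hk, ← ih (by lia)]
      rfl
  refine ⟨z 0, fun k hk ↦ ?_, by rw [horb N le_rfl, hz]⟩
  rw [horb k hk]
  exact (hzd k hk).trans_lt hq'

theorem sum_range_exp_neg_mul_le {θ : ℝ} (hθ : 0 < θ) (N : ℕ) :
    ∑ i ∈ Finset.range N, Real.exp (-θ * ((N : ℝ) - i)) ≤ (1 - Real.exp (-θ))⁻¹ := by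
  have h1 : Real.exp (-θ) < 1 := Real.exp_lt_one_iff.2 (by linarith)
  have h2 : ∑ i ∈ Finset.range N, Real.exp (-θ * ((N : ℝ) - i)) ≤
      ∑ i ∈ Finset.range N, Real.exp (-θ) ^ i := by
    rw [← Finset.sum_range_reflect (fun i ↦ Real.exp (-θ) ^ i)]
    refine Finset.sum_le_sum fun i hi ↦ ?_
    rw [← Real.exp_nat_mul, Real.exp_le_exp]
    have : i + 1 ≤ N := Finset.mem_range.1 hi
    have h3 : ((N - 1 - i : ℕ) : ℝ) = N - 1 - i := by
      rw [Nat.cast_sub (by lia), Nat.cast_sub (by lia)]; simp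
    rw [h3]
    nlinarith
  refine h2.trans ?_
  rw [← tsum_geometric_of_lt_one (Real.exp_pos _).le h1]
  exact (summable_geometric_of_lt_one (Real.exp_pos _).le h1).sum_le_tsum _
    fun i _ ↦ pow_nonneg (Real.exp_pos _).le i

/-- Bounded distortion at hyperbolic times. -/
theorem hasDistortionOn_bowenBall [MeasurableSpace X] {m : Measure X} (hc : 0 < c)
    (hν : ∀ i p, 0 < ν i p) {r : ℝ} (hr : 0 < r)
    (hf : ∀ i p, HasInverseBranchBound (f i) p (Real.exp (c / 2) * ν i p) (ENNReal.ofReal r))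
    {C α : ℝ} (hC : 0 ≤ C) (hα : 0 < α)
    (hD : ∀ i p s, 0 < s → s ≤ r →
      HasDistortionOn m (f i) (Metric.eball p (ENNReal.ofReal s)) (C * s ^ α))
    (hN : IsHyperbolicTime c (fun i ↦ Real.log (ν (w i) (orbitalBranch f w i x))) N) :
    HasDistortionOn m (orbitalBranch f w N)
      (bowenBall (orbitalBranch f w) N x (ENNReal.ofReal r))
      (C * r ^ α * (1 - Real.exp (-(c / 2 * α)))⁻¹) := by
  -- At time `k` the Bowen ball has been carried into a ball of radius `exp (-(c / 2) * (N - k)) *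
  -- r`; inserting this radius into `hD` gives the summand.
  have H : ∀ k ≤ N, HasDistortionOn m (orbitalBranch f w k)
      (bowenBall (orbitalBranch f w) N x (ENNReal.ofReal r))
      (∑ i ∈ Finset.range k, C * r ^ α * Real.exp (-(c / 2 * α) * ((N : ℝ) - i))) := by
    intro k
    induction k with
    | zero => intro _; simpa using! hasDistortionOn_id _
    | succ k ih =>
      intro hk
      have hkN : (k : ℝ) ≤ N := by exact_mod_cast (by lia : k ≤ N)
      rw [Finset.sum_range_succ]
      have h1 := hD (w k) (orbitalBranch f w k x) (Real.exp (-(c / 2) * ((N : ℝ) - k)) * r)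
        (by positivity) (mul_le_of_le_one_left hr.le (Real.exp_le_one_iff.2 (by nlinarith)))
      have h2 : C * (Real.exp (-(c / 2) * ((N : ℝ) - k)) * r) ^ α =
          C * r ^ α * Real.exp (-(c / 2 * α) * ((N : ℝ) - k)) := by
        rw [Real.mul_rpow (Real.exp_pos _).le hr.le, ← Real.exp_mul]
        ring_nf
      rw [h2] at h1
      refine HasDistortionOn.comp h1 (ih (by lia)) fun y hy ↦ ?_
      have h3 := edist_orbitalBranch_le hν hf hN hy (by lia : k ≤ N)
      refine h3.trans_lt ?_
      rw [ENNReal.ofReal_mul (Real.exp_pos _).le]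
      exact ENNReal.mul_lt_mul_right (by simp [Real.exp_pos]) ENNReal.ofReal_ne_top (hy N le_rfl)
  refine (H N le_rfl).mono ?_
  rw [← Finset.mul_sum]
  gcongr
  exact sum_range_exp_neg_mul_le (by positivity) N

end Expanding

/-! ### The covering argument in a compact metric space. -/

section Main

variable {X : Type*} [EMetricSpace X] [CompactSpace X] [MeasurableSpace X]

/-- If no nonempty open set is contained in `A` modulo `m`, then the balls of a given radius meet
the complement of `A` in measure bounded from below. -/
theorem exists_le_measure_eball_diff (m : Measure X) {A : Set X}
    (hA : ∀ B : Set X, IsOpen B → B.Nonempty → m (B \ A) ≠ 0) {δ : ℝ≥0∞} (hδ : 0 < δ) :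
    ∃ b : ℝ≥0∞, b ≠ 0 ∧ ∀ x, b ≤ m (Metric.eball x δ \ A) := by
  have hδ2 : 0 < δ / 2 := ENNReal.half_pos hδ.ne'
  obtain ⟨t, -, ht⟩ := isCompact_univ.elim_nhds_subcover (fun x : X ↦ Metric.eball x (δ / 2))
    fun x _ ↦ Metric.eball_mem_nhds x hδ2
  -- Every ball of radius `δ` contains one of the finitely many covering balls of radius `δ / 2`.
  refine ⟨t.inf fun y ↦ m (Metric.eball y (δ / 2) \ A), ?_, fun x ↦ ?_⟩
  · rw [← pos_iff_ne_zero, Finset.lt_inf_iff (by simp)]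
    exact fun y _ ↦ pos_iff_ne_zero.2
      (hA _ Metric.isOpen_eball ⟨y, Metric.mem_eball_self hδ2⟩)
  · obtain ⟨y, hyt, hy⟩ := mem_iUnion₂.1 (ht (mem_univ x))
    refine (Finset.inf_le hyt).trans (measure_mono (sdiff_subset_sdiff_left fun z hz ↦ ?_))
    calc edist z x ≤ edist z y + edist x y := edist_triangle_right z x y
      _ < δ / 2 + δ / 2 := ENNReal.add_lt_add hz hy
      _ = δ := ENNReal.add_halves δ

variable [BorelSpace X] {d : ℕ} {f : Fin d → X → X} {w : ℕ → Fin d} {ν : Fin d → X → ℝ}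
  {A : Set X}

/-- A forward invariant set in which infinitely many hyperbolic times occur on a set of positive
measure contains a nonempty open set modulo a null set. -/
theorem exists_isOpen_of_frequently_isHyperbolicTime (m : Measure X) [IsFiniteMeasure m]
    {c : ℝ} (hc : 0 < c) (hcont : ∀ i, Continuous (f i)) (hν : ∀ i p, 0 < ν i p)
    {r : ℝ} (hr : 0 < r)
    (hf : ∀ i p, HasInverseBranchBound (f i) p (Real.exp (c / 2) * ν i p) (ENNReal.ofReal r))
    {C α : ℝ} (hC : 0 ≤ C) (hα : 0 < α)
    (hD : ∀ i p s, 0 < s → s ≤ r →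
      HasDistortionOn m (f i) (Metric.eball p (ENNReal.ofReal s)) (C * s ^ α))
    (hAm : NullMeasurableSet A m) (hinv : ∀ i, MapsTo (f i) A A) {A' : Set X} (hA'A : A' ⊆ A)
    (hA' : m A' ≠ 0)
    (hhyp : ∀ x ∈ A', ∃ᶠ N in atTop,
      IsHyperbolicTime c (fun i ↦ Real.log (ν (w i) (orbitalBranch f w i x))) N) :
    ∃ B : Set X, IsOpen B ∧ B.Nonempty ∧ m (B \ A) = 0 := by
  by_contra! hB
  set F := orbitalBranch f w with hF
  have hFcont : ∀ k, Continuous (F k) := by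
    intro k
    induction k with
    | zero => exact continuous_id
    | succ k ih => exact (hcont _).comp ih
  have hFinv : ∀ k, MapsTo (F k) A A := by
    intro k
    induction k with
    | zero => exact mapsTo_id _
    | succ k ih => exact (hinv _).comp ih
  -- A third of `r`, so that the threefold enlarged Bowen balls still have radius `r`, where
  -- distortion is bounded.
  set δ : ℝ≥0∞ := ENNReal.ofReal (r / 3) with hδ
  have hδ0 : 0 < δ := ENNReal.ofReal_pos.2 (by positivity)
  have h3δ : 3 * δ = ENNReal.ofReal r := by
    rw [hδ, ← ENNReal.ofReal_ofNat, ← ENNReal.ofReal_mul (by norm_num)]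
    congr 1
    ring
  have hδr : δ ≤ ENNReal.ofReal r := ENNReal.ofReal_le_ofReal (by linarith)
  obtain ⟨b, hb0, hb⟩ := exists_le_measure_eball_diff m hB hδ0
  obtain ⟨A₀, hA₀A, hA₀m, hA₀⟩ := hAm.exists_measurable_subset_ae_eq
  set κ := C * r ^ α * (1 - Real.exp (-(c / 2 * α)))⁻¹ with hκ
  set K : ℝ≥0∞ := ENNReal.ofReal (Real.exp (2 * κ)) * m univ / b with hK
  have hKtop : K ≠ ⊤ :=
    ENNReal.div_ne_top (ENNReal.mul_ne_top ENNReal.ofReal_ne_top (measure_ne_top m _)) hb0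
  -- the measure of an enlarged Bowen ball is controlled by that of the part of the ball outside `A`
  have key : ∀ x N, IsHyperbolicTime c (fun i ↦ Real.log (ν (w i) (F i x))) N →
      m (bowenBall F N x (3 * δ)) ≤ K * m (bowenBall F N x δ \ A₀) := by
    intro x N hN
    have hdist := hasDistortionOn_bowenBall (m := m) hc hν hr hf hC hα hD hN
    rw [← h3δ] at hdist
    have hsub : bowenBall F N x δ \ A₀ ⊆ bowenBall F N x (3 * δ) := fun y hy k hk ↦
      (hy.1 k hk).trans_le (hδr.trans_eq h3δ.symm)
    have h1 := hdist.measure_mul_le (isOpen_bowenBall hFcont N x _).measurableSet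
      ((isOpen_bowenBall hFcont N x δ).measurableSet.diff hA₀m) hsub
    have h2 : b ≤ m (F N '' (bowenBall F N x δ \ A₀)) := by
      -- A point of the ball outside `A` has a preimage in the Bowen ball, which lies outside `A` by
      -- forward invariance.
      refine (hb (F N x)).trans (measure_mono fun q hq ↦ ?_)
      obtain ⟨y, hy, rfl⟩ := eball_subset_image_bowenBall hc hν hf hN hδr hq.1
      exact ⟨y, ⟨hy, fun hyA ↦ hq.2 (hFinv N (hA₀A hyA))⟩, rfl⟩
    have hbtop : b ≠ ⊤ := (h2.trans_lt (measure_lt_top m _)).ne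
    rw [hK, div_eq_mul_inv, mul_assoc, mul_comm b⁻¹, ← mul_assoc, ← div_eq_mul_inv,
      ENNReal.le_div_iff_mul_le (Or.inl hb0) (Or.inl hbtop), mul_comm]
    exact (by gcongr : b * _ ≤ _).trans h1
  -- small measure of a neighbourhood outside `A`
  have hall : ∀ ε : ℝ≥0∞, ε ≠ 0 → m A' ≤ K * ε := by
    intro ε hε
    obtain ⟨U, hAU, hUo, hU⟩ := A.exists_isOpen_lt_add (measure_ne_top m _) hε
    have hUA₀ : m (U \ A₀) ≤ ε := by
      rw [measure_sdiff (hA₀A.trans hAU) hA₀m.nullMeasurableSet (measure_ne_top m _),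
        measure_congr hA₀, tsub_le_iff_left]
      exact hU.le
    have hsmall : ∀ x ∈ A', ∃ N, IsHyperbolicTime c (fun i ↦ Real.log (ν (w i) (F i x))) N ∧
        bowenBall F N x δ ⊆ U := by
      intro x hx
      obtain ⟨η, hη0, hη⟩ := EMetric.isOpen_iff.1 hUo x (hAU (hA'A hx))
      have htend : Tendsto (fun N : ℕ ↦ ENNReal.ofReal (Real.exp (-(c / 2) * N)) * δ) atTop
          (nhds 0) := by
        have h1 : Tendsto (fun N : ℕ ↦ Real.exp (-(c / 2) * (N : ℝ))) atTop (nhds 0) :=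
          Real.tendsto_exp_atBot.comp
            (tendsto_natCast_atTop_atTop.const_mul_atTop_of_neg (by linarith))
        have h2 := ENNReal.Tendsto.mul_const (ENNReal.tendsto_ofReal h1)
          (Or.inr (ENNReal.ofReal_ne_top : δ ≠ ⊤))
        simpa using h2
      -- A late hyperbolic time makes the Bowen ball small at time `0`, hence contained in `U`.
      obtain ⟨N, hN, hNη⟩ := ((hhyp x hx).and_eventually (htend.eventually_lt_const hη0)).exists
      refine ⟨N, hN, fun y hy ↦ hη ?_⟩
      have h1 := edist_orbitalBranch_le hν hf hN (fun k hk ↦ (hy k hk).trans_le hδr)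
        (Nat.zero_le N)
      simp only [CharP.cast_eq_zero, sub_zero] at h1
      refine lt_of_le_of_lt (h1.trans ?_) hNη
      gcongr
      exact (hy N le_rfl).le
    choose! T hT hTU using hsmall
    -- The size of a Bowen ball is declared to be `2⁻¹ ^ T x`. Since `3 / 2 < 2`, the size
    -- comparison in Vitali's lemma forces `T y ≤ T x` for the selected ball, which is what the
    -- engulfing property requires.
    obtain ⟨u, huA', hdisj, hcov⟩ := Vitali.exists_disjoint_subfamily_covering_enlargement
      (fun x ↦ bowenBall F (T x) x δ) A' (fun x ↦ (2 : ℝ)⁻¹ ^ T x) (3 / 2) (by norm_num)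
      (fun x _ ↦ by positivity) 1 (fun x _ ↦ pow_le_one₀ (by norm_num) (by norm_num))
      (fun x _ ↦ ⟨x, mem_bowenBall_self F _ x hδ0⟩)
    have hcount : u.Countable := hdisj.countable_of_isOpen
      (fun x _ ↦ isOpen_bowenBall hFcont _ x δ) (fun x _ ↦ ⟨x, mem_bowenBall_self F _ x hδ0⟩)
    have hcover : A' ⊆ ⋃ x ∈ u, bowenBall F (T x) x (3 * δ) := by
      intro x hx
      obtain ⟨y, hyu, hne, hle⟩ := hcov x hx
      have hTle : T y ≤ T x := by
        by_contra! hlt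
        have h1 : (2 : ℝ)⁻¹ ^ T y ≤ (2 : ℝ)⁻¹ ^ (T x + 1) :=
          pow_le_pow_of_le_one (by norm_num) (by norm_num) hlt
        have h2 : (0 : ℝ) < (2 : ℝ)⁻¹ ^ T x := by positivity
        rw [pow_succ] at h1
        linarith
      exact mem_iUnion₂.2 ⟨y, hyu,
        bowenBall_subset_of_inter_nonempty hTle hne (mem_bowenBall_self F _ x hδ0)⟩
    calc m A' ≤ m (⋃ x ∈ u, bowenBall F (T x) x (3 * δ)) := measure_mono hcover
      _ ≤ ∑' x : u, m (bowenBall F (T x) x (3 * δ)) := measure_biUnion_le m hcount _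
      _ ≤ ∑' x : u, K * m (bowenBall F (T x) x δ \ A₀) :=
          ENNReal.tsum_le_tsum fun x ↦ key x _ (hT x (huA' x.2))
      _ = K * ∑' x : u, m (bowenBall F (T x) x δ \ A₀) := ENNReal.tsum_mul_left
      _ = K * m (⋃ x ∈ u, bowenBall F (T x) x δ \ A₀) := by
          rw [measure_biUnion hcount (hdisj.mono fun x ↦ sdiff_subset)
            fun x _ ↦ (isOpen_bowenBall hFcont _ x δ).measurableSet.diff hA₀m]
      _ ≤ K * ε := by
          gcongr
          refine (measure_mono (iUnion₂_subset fun x hx ↦ ?_)).trans hUA₀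
          exact sdiff_subset_sdiff_left (hTU x (huA' hx))
  refine hA' (le_antisymm (ge_of_tendsto' (f := fun n : ℕ ↦ K * ((n : ℝ≥0∞) + 1)⁻¹)
    (x := atTop) ?_ fun n ↦ hall _ (by simp)) zero_le)
  have h1 : Tendsto (fun n : ℕ ↦ ((n : ℝ≥0∞) + 1)⁻¹) atTop (nhds 0) := by
    have := (tendsto_add_atTop_iff_nat 1).2 ENNReal.tendsto_inv_nat_nhds_zero
    simpa using this
  simpa using ENNReal.Tendsto.const_mul h1 (Or.inr hKtop)

/-- A forward invariant set of positive measure contains a nonempty open set modulo a null set, if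
the maps are non-uniformly expanding along an orbital branch. -/
theorem exists_isOpen_measure_diff_eq_zero (m : Measure X) [IsFiniteMeasure m]
    (hcont : ∀ i, Continuous (f i)) (hν : ∀ i p, 0 < ν i p)
    (hL : ∀ ε > 0, ∃ r > 0, ∀ i p,
      HasInverseBranchBound (f i) p (Real.exp ε * ν i p) (ENNReal.ofReal r))
    {C α : ℝ} (hC : 0 ≤ C) (hα : 0 < α)
    (hD : ∃ r > 0, ∀ i p s, 0 < s → s ≤ r →
      HasDistortionOn m (f i) (Metric.eball p (ENNReal.ofReal s)) (C * s ^ α))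
    (hexp : ∀ᵐ x ∂m, limsup (fun N : ℕ ↦ (((1 / (N : ℝ)) * ∑ i ∈ Finset.range N,
      Real.log (ν (w i) (orbitalBranch f w i x)) : ℝ) : EReal)) atTop < 0)
    (hAm : NullMeasurableSet A m) (hinv : ∀ i, MapsTo (f i) A A) (hA : m A ≠ 0) :
    ∃ B : Set X, IsOpen B ∧ B.Nonempty ∧ m (B \ A) = 0 := by
  set P : ℕ → Set X := fun j ↦ {x ∈ A | ∃ᶠ N in atTop, IsHyperbolicTime (1 / ((j : ℝ) + 1))
    (fun i ↦ Real.log (ν (w i) (orbitalBranch f w i x))) N} with hP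
  have hcover : m (A \ ⋃ j, P j) = 0 := by
    refine measure_mono_null (fun x hx ↦ ?_) hexp
    intro h
    obtain ⟨j, hj⟩ := exists_eventually_sum_le_of_limsup_neg h
    exact hx.2 (mem_iUnion.2 ⟨j, hx.1, frequently_isHyperbolicTime (by positivity) hj⟩)
  -- `P j` need not be measurable: the covering argument uses only its outer measure.
  obtain ⟨j, hj⟩ : ∃ j, m (P j) ≠ 0 := by
    by_contra! h
    refine hA (measure_mono_null (t := (A \ ⋃ j, P j) ∪ ⋃ j, P j) ?_
      (measure_union_null hcover (measure_iUnion_null h)))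
    rw [sdiff_union_self]
    exact subset_union_left
  have hc : (0 : ℝ) < 1 / ((j : ℝ) + 1) := by positivity
  obtain ⟨r₁, hr₁, h₁⟩ := hL (1 / ((j : ℝ) + 1) / 2) (by positivity)
  obtain ⟨r₂, hr₂, h₂⟩ := hD
  exact exists_isOpen_of_frequently_isHyperbolicTime m hc hcont hν (lt_min hr₁ hr₂)
    (fun i p ↦ (h₁ i p).mono le_rfl (ENNReal.ofReal_le_ofReal (min_le_left _ _))) hC hα
    (fun i p s hs hs' ↦ h₂ i p s hs (hs'.trans (min_le_right _ _))) hAm hinv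
    (fun x hx ↦ hx.1) hj fun x hx ↦ hx.2

end Main

/-! ### Continuity of operator norms in Riemannian bundles. -/

section OperatorNorm

variable {B : Type*} [TopologicalSpace B]
  {F : Type*} [NormedAddCommGroup F] [NormedSpace ℝ F]
  {E : B → Type*} [TopologicalSpace (TotalSpace F E)] [∀ x, NormedAddCommGroup (E x)]
  [∀ x, InnerProductSpace ℝ (E x)] [FiberBundle F E] [VectorBundle ℝ F E]
  [IsContinuousRiemannianBundle F E]
  {B' : Type*} [TopologicalSpace B']
  {F' : Type*} [NormedAddCommGroup F'] [NormedSpace ℝ F']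
  {E' : B' → Type*} [TopologicalSpace (TotalSpace F' E')] [∀ x, NormedAddCommGroup (E' x)]
  [∀ x, InnerProductSpace ℝ (E' x)] [FiberBundle F' E'] [VectorBundle ℝ F' E']
  [IsContinuousRiemannianBundle F' E']
  {Z : Type*} [TopologicalSpace Z] {b : Z → B} {b' : Z → B'} {z₀ : Z}

/-- In continuous Riemannian bundles, the operator norm of a family of linear maps between fibers
is continuous at a point where the family, read in trivializations, is continuous. -/
theorem tendsto_norm_of_continuousAt_inCoordinates (hb : ContinuousAt b z₀)
    (hb' : ContinuousAt b' z₀) (φ : ∀ z, E (b z) →L[ℝ] E' (b' z))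
    (hφ : ContinuousAt (fun z ↦ ContinuousLinearMap.inCoordinates F E F' E' (b z₀) (b z) (b' z₀)
      (b' z) (φ z)) z₀) :
    Tendsto (fun z ↦ ‖φ z‖) (𝓝 z₀) (𝓝 ‖φ z₀‖) := by
  set τ := trivializationAt F E (b z₀) with hτ
  set τ' := trivializationAt F' E' (b' z₀) with hτ'
  -- `ψ z` is `φ z` transported to the fixed fibres over `z₀`. It varies continuously in one normed
  -- space, and the transports have norm less than any `r > 1` near `z₀`, so the norms of `φ z` and
  -- `ψ z` have the same limit.
  set ψ : Z → E (b z₀) →L[ℝ] E' (b' z₀) := fun z ↦ (τ'.symmL ℝ (b' z₀)) ∘L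
    (ContinuousLinearMap.inCoordinates F E F' E' (b z₀) (b z) (b' z₀) (b' z) (φ z)) ∘L
      (τ.continuousLinearMapAt ℝ (b z₀)) with hψ
  have hψc : ContinuousAt ψ z₀ :=
    continuousAt_const.clm_comp (hφ.clm_comp continuousAt_const)
  have hmem : ∀ᶠ z in 𝓝 z₀, b z ∈ τ.baseSet := hb.preimage_mem_nhds
    (τ.open_baseSet.mem_nhds (mem_baseSet_trivializationAt F E (b z₀)))
  have hmem' : ∀ᶠ z in 𝓝 z₀, b' z ∈ τ'.baseSet := hb'.preimage_mem_nhds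
    (τ'.open_baseSet.mem_nhds (mem_baseSet_trivializationAt F' E' (b' z₀)))
  have hm0 := hmem.self_of_nhds
  have hm0' := hmem'.self_of_nhds
  have hψφ : ∀ᶠ z in 𝓝 z₀, ψ z = ((τ'.symmL ℝ (b' z₀)) ∘L (τ'.continuousLinearMapAt ℝ (b' z))) ∘L
      φ z ∘L ((τ.symmL ℝ (b z)) ∘L (τ.continuousLinearMapAt ℝ (b z₀))) := by
    filter_upwards [hmem, hmem'] with z hz hz'
    rfl
  have hφψ : ∀ᶠ z in 𝓝 z₀, φ z = ((τ'.symmL ℝ (b' z)) ∘L (τ'.continuousLinearMapAt ℝ (b' z₀))) ∘L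
      ψ z ∘L ((τ.symmL ℝ (b z₀)) ∘L (τ.continuousLinearMapAt ℝ (b z))) := by
    filter_upwards [hmem, hmem', hψφ] with z hz hz' h
    rw [h]
    ext v
    simp [hz, hz', hm0, hm0', -Trivialization.continuousLinearMapAt_apply,
      -Trivialization.symmL_apply, Trivialization.continuousLinearMapAt_symmL,
      Trivialization.symmL_continuousLinearMapAt]
  have hψ0 : ψ z₀ = φ z₀ := by
    rw [hψφ.self_of_nhds]
    ext v
    simp [hm0, hm0', -Trivialization.continuousLinearMapAt_apply,
      -Trivialization.symmL_apply, Trivialization.symmL_continuousLinearMapAt]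
  have hψn : Tendsto (fun z ↦ ‖ψ z‖) (𝓝 z₀) (𝓝 ‖φ z₀‖) := by
    rw [← hψ0]
    exact hψc.norm
  have upper : ∀ r : ℝ, 1 < r → ∀ᶠ z in 𝓝 z₀, ‖φ z‖ ≤ r * (‖ψ z‖ * r) := by
    intro r hr
    filter_upwards [hφψ,
      hb.eventually (eventually_norm_symmL_trivializationAt_self_comp_lt F E (b z₀) hr),
      hb'.eventually (eventually_norm_symmL_trivializationAt_comp_self_lt F' E' (b' z₀) hr)]
      with z h h1 h2
    rw [h]
    refine (ContinuousLinearMap.opNorm_comp_le _ _).trans ?_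
    refine mul_le_mul h2.le ((ContinuousLinearMap.opNorm_comp_le _ _).trans ?_) (norm_nonneg _)
      (by linarith)
    exact mul_le_mul_of_nonneg_left h1.le (norm_nonneg _)
  have lower : ∀ r : ℝ, 1 < r → ∀ᶠ z in 𝓝 z₀, ‖ψ z‖ ≤ r * (‖φ z‖ * r) := by
    intro r hr
    filter_upwards [hψφ,
      hb.eventually (eventually_norm_symmL_trivializationAt_comp_self_lt F E (b z₀) hr),
      hb'.eventually (eventually_norm_symmL_trivializationAt_self_comp_lt F' E' (b' z₀) hr)]
      with z h h1 h2
    rw [h]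
    refine (ContinuousLinearMap.opNorm_comp_le _ _).trans ?_
    refine mul_le_mul h2.le ((ContinuousLinearMap.opNorm_comp_le _ _).trans ?_) (norm_nonneg _)
      (by linarith)
    exact mul_le_mul_of_nonneg_left h1.le (norm_nonneg _)
  have hr : ∀ c : ℝ, Tendsto (fun r : ℝ ↦ r * (c * r)) (𝓝[>] 1) (𝓝 c) := fun c ↦ by
    have : Continuous fun r : ℝ ↦ r * (c * r) := by fun_prop
    simpa using (this.tendsto 1).mono_left nhdsWithin_le_nhds
  refine tendsto_order.2 ⟨fun K hK ↦ ?_, fun K hK ↦ ?_⟩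
  · obtain ⟨K', hKK', hK'⟩ := exists_between hK
    obtain ⟨r, hrK, hr1⟩ := (((hr K).eventually (eventually_lt_nhds hKK')).and
      self_mem_nhdsWithin).exists
    filter_upwards [lower r hr1, hψn.eventually (eventually_gt_nhds hK')] with z h1 h2
    have hr1' : (1 : ℝ) < r := hr1
    by_contra! h3
    have : r * (‖φ z‖ * r) ≤ r * (K * r) := by gcongr
    linarith
  · obtain ⟨K', hK', hKK'⟩ := exists_between hK
    obtain ⟨r, hrK, hr1⟩ := (((hr K').eventually (eventually_lt_nhds hKK')).and
      self_mem_nhdsWithin).exists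
    filter_upwards [upper r hr1, hψn.eventually (eventually_lt_nhds hK')] with z h1 h2
    have hr1' : (1 : ℝ) < r := hr1
    have : r * (‖ψ z‖ * r) ≤ r * (K' * r) := by gcongr
    linarith

end OperatorNorm

/-! ### Local Lipschitz constants from derivatives. -/

section Lipschitz

variable {E : Type*} [NormedAddCommGroup E] [NormedSpace ℝ E]
  {H : Type*} [TopologicalSpace H] {I : ModelWithCorners ℝ E H}
  {M : Type*} [TopologicalSpace M] [ChartedSpace H M]
  [RiemannianBundle (fun x : M ↦ TangentSpace I x)]
  {E' : Type*} [NormedAddCommGroup E'] [NormedSpace ℝ E']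
  {H' : Type*} [TopologicalSpace H'] {I' : ModelWithCorners ℝ E' H'}
  {M' : Type*} [TopologicalSpace M'] [ChartedSpace H' M']
  [RiemannianBundle (fun x : M' ↦ TangentSpace I' x)]

/-- A `C^1` map increases the length of paths at most by the supremum of the norm of its
derivative. -/
theorem pathELength_comp_le {h : M → M'} {O : Set M} (hO : IsOpen O)
    (hh : ContMDiffOn I I' 1 h O) {K : ℝ≥0∞} (hKtop : K ≠ ⊤)
    (hK : ∀ x ∈ O, ‖mfderiv I I' h x‖ₑ ≤ K) {γ : ℝ → M}
    (hγ : ContMDiff 𝓘(ℝ, ℝ) I 1 γ) (hγO : ∀ t ∈ Icc (0 : ℝ) 1, γ t ∈ O) :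
    Manifold.pathELength I' (h ∘ γ) 0 1 ≤ K * Manifold.pathELength I γ 0 1 := by
  rw [Manifold.pathELength_eq_lintegral_mfderiv_Icc, Manifold.pathELength_eq_lintegral_mfderiv_Icc,
    ← lintegral_const_mul' _ _ hKtop]
  refine setLIntegral_mono' measurableSet_Icc fun t ht ↦ ?_
  have hd : MDifferentiableAt I I' h (γ t) :=
    (hh.contMDiffAt (hO.mem_nhds (hγO t ht))).mdifferentiableAt one_ne_zero
  have h1 : mfderiv 𝓘(ℝ, ℝ) I' (h ∘ γ) t = (mfderiv I I' h (γ t)) ∘L (mfderiv 𝓘(ℝ, ℝ) I γ t) :=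
    mfderiv_comp t hd (hγ.mdifferentiable one_ne_zero t)
  have h2 : mfderiv 𝓘(ℝ, ℝ) I' (h ∘ γ) t 1 =
      (mfderiv I I' h (γ t)) (mfderiv 𝓘(ℝ, ℝ) I γ t 1) := congr($h1 1)
  rw [h2]
  refine (ContinuousLinearMap.le_opENorm _ _).trans ?_
  gcongr
  exact hK _ (hγO t ht)

variable [IsManifold I 1 M] [IsManifold I' 1 M']

/-- The Riemannian operator norm of the derivative of a `C^1` map is continuous. -/
theorem tendsto_norm_mfderiv [IsContinuousRiemannianBundle E (fun x : M ↦ TangentSpace I x)]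
    [IsContinuousRiemannianBundle E' (fun x : M' ↦ TangentSpace I' x)] {h : M → M'} {x₀ : M}
    (hh : ContMDiffAt I I' 1 h x₀) :
    Tendsto (fun x ↦ ‖mfderiv I I' h x‖) (𝓝 x₀) (𝓝 ‖mfderiv I I' h x₀‖) := by
  have h1 : ContMDiffAt I 𝓘(ℝ, E →L[ℝ] E') 0
      (inTangentCoordinates I I' id h (fun x ↦ mfderiv I I' h x) x₀) x₀ :=
    hh.mfderiv_const (by simp)
  exact tendsto_norm_of_continuousAt_inCoordinates (F := E) (F' := E')
    (E := fun x : M ↦ TangentSpace I x) (E' := fun x : M' ↦ TangentSpace I' x)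
    (b := id) (b' := h) continuousAt_id hh.continuousAt (fun x ↦ mfderiv I I' h x) h1.continuousAt

/-- A `C^1` map between Riemannian manifolds is locally Lipschitz, with any constant larger than the
norm of its derivative at the point. -/
theorem exists_nhds_riemannianEDist_le [RegularSpace M]
    [IsContinuousRiemannianBundle E (fun x : M ↦ TangentSpace I x)]
    [IsContinuousRiemannianBundle E' (fun x : M' ↦ TangentSpace I' x)] {h : M → M'} {x₀ : M}
    (hh : ContMDiffAt I I' 1 h x₀) {K : ℝ} (hK : ‖mfderiv I I' h x₀‖ < K) :
    ∃ V ∈ 𝓝 x₀, ∀ x ∈ V, ∀ y ∈ V, Manifold.riemannianEDist I' (h x) (h y) ≤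
      ENNReal.ofReal K * Manifold.riemannianEDist I x y := by
  obtain ⟨O, hO, hhO⟩ := (contMDiffAt_iff_contMDiffOn_nhds (by simp)).1 hh
  have hev : ∀ᶠ x in 𝓝 x₀, ‖mfderiv I I' h x‖ < K :=
    (tendsto_norm_mfderiv hh).eventually (eventually_lt_nhds hK)
  obtain ⟨O', hO'sub, hO'open, hO'mem⟩ := mem_nhds_iff.1 (inter_mem hO hev)
  obtain ⟨c, hc, hcO⟩ := setOfPred_riemannianEDist_lt_subset_nhds' I (hO'open.mem_nhds hO'mem)
  have hc3 : 0 < c / 3 := ENNReal.div_pos hc.ne' (by simp)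
  -- Points within `c / 3` of `x₀` are joined by paths of length less than `2c / 3`; such a path
  -- stays within `c` of `x₀`, where the derivative is bounded by `K`.
  refine ⟨{y | Manifold.riemannianEDist I x₀ y < c / 3}, eventually_riemannianEDist_lt I x₀ hc3,
    fun x hx y hy ↦ ?_⟩
  simp only [mem_ofPred_eq] at hx hy
  have hxy : Manifold.riemannianEDist I x y < c / 3 + c / 3 := by
    refine Manifold.riemannianEDist_triangle.trans_lt (ENNReal.add_lt_add ?_ hy)
    rwa [Manifold.riemannianEDist_comm]
  have hKtop : ENNReal.ofReal K ≠ ⊤ := ENNReal.ofReal_ne_top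
  have hstep : ∀ r, Manifold.riemannianEDist I x y < r → r < c / 3 + c / 3 →
      Manifold.riemannianEDist I' (h x) (h y) ≤ ENNReal.ofReal K * r := by
    intro r hr hrc
    obtain ⟨γ, hγ0, hγ1, hγs, hγl, -⟩ :=
      Manifold.exists_lt_locally_constant_of_riemannianEDist_lt hr zero_lt_one
    have hγO : ∀ t ∈ Icc (0 : ℝ) 1, γ t ∈ O' := by
      intro t ht
      refine hcO ?_
      have h1 : Manifold.riemannianEDist I x (γ t) ≤ Manifold.pathELength I γ 0 t :=
        Manifold.riemannianEDist_le_pathELength hγs.contMDiffOn hγ0 rfl ht.1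
      have h2 : Manifold.riemannianEDist I x (γ t) < c / 3 + c / 3 :=
        (h1.trans (Manifold.pathELength_mono le_rfl ht.2)).trans_lt (hγl.trans hrc)
      calc Manifold.riemannianEDist I x₀ (γ t)
          ≤ Manifold.riemannianEDist I x₀ x + Manifold.riemannianEDist I x (γ t) :=
            Manifold.riemannianEDist_triangle
        _ < c / 3 + (c / 3 + c / 3) := ENNReal.add_lt_add hx h2
        _ = c := by rw [← add_assoc]; exact ENNReal.add_thirds c
    have hhO' : ContMDiffOn I I' 1 h O' := hhO.mono fun z hz ↦ (hO'sub hz).1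
    calc Manifold.riemannianEDist I' (h x) (h y)
        ≤ Manifold.pathELength I' (h ∘ γ) 0 1 :=
          Manifold.riemannianEDist_le_pathELength
            (hhO'.comp hγs.contMDiffOn fun t ht ↦ hγO t ht)
            (by simp [hγ0]) (by simp [hγ1]) zero_le_one
      _ ≤ ENNReal.ofReal K * Manifold.pathELength I γ 0 1 := by
          refine pathELength_comp_le hO'open hhO' hKtop (fun z hz ↦ ?_) hγs hγO
          rw [← ofReal_norm]
          exact ENNReal.ofReal_le_ofReal (hO'sub hz).2.le
      _ ≤ ENNReal.ofReal K * r := by gcongr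
  -- The distance need not be attained by a path, so `r` decreases to it.
  have hne : (𝓝[>] (Manifold.riemannianEDist I x y)).NeBot := nhdsGT_neBot_of_exists_gt ⟨_, hxy⟩
  have hlim : Tendsto (fun r ↦ ENNReal.ofReal K * r) (𝓝[>] (Manifold.riemannianEDist I x y))
      (𝓝 (ENNReal.ofReal K * Manifold.riemannianEDist I x y)) :=
    (ENNReal.Tendsto.const_mul tendsto_id (Or.inr hKtop)).mono_left nhdsWithin_le_nhds
  refine ge_of_tendsto hlim ?_
  filter_upwards [self_mem_nhdsWithin, nhdsWithin_le_nhds (Iio_mem_nhds hxy)] with r h1 h2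
  exact hstep r h1 h2

end Lipschitz

theorem isContinuousRiemannianBundle_of_contMDiff
    {E : Type*} [NormedAddCommGroup E] [NormedSpace ℝ E]
    {H : Type*} [TopologicalSpace H] {I : ModelWithCorners ℝ E H}
    {M : Type*} [TopologicalSpace M] [ChartedSpace H M] [IsManifold I 1 M]
    [RiemannianBundle (fun x : M ↦ TangentSpace I x)] {k : ℕ∞ω}
    [h : IsContMDiffRiemannianBundle I k E (fun x : M ↦ TangentSpace I x)] :
    IsContinuousRiemannianBundle E (fun x : M ↦ TangentSpace I x) := by
  obtain ⟨g, hg, hg'⟩ := h.exists_contMDiff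
  exact ⟨g, hg.continuous, hg'⟩

/-- A property of points and scales which holds locally at some scale holds at a uniform scale on a
compact space. -/
theorem exists_pos_forall_of_compactSpace {X : Type*} [TopologicalSpace X] [CompactSpace X]
    {P : X → ℝ → Prop} (hP : ∀ x r r', r' ≤ r → P x r → P x r')
    (h : ∀ x₀, ∃ r > 0, ∀ᶠ x in 𝓝 x₀, P x r) : ∃ r > 0, ∀ x, P x r := by
  have : ∃ r > 0, ∀ x ∈ (univ : Set X), P x r := by
    refine isCompact_univ.induction_on (p := fun S ↦ ∃ r > 0, ∀ x ∈ S, P x r)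
      ⟨1, one_pos, by simp⟩ ?_ ?_ ?_
    · rintro S T hST ⟨r, hr, hT⟩
      exact ⟨r, hr, fun x hx ↦ hT x (hST hx)⟩
    · rintro S T ⟨r, hr, hS⟩ ⟨r', hr', hT⟩
      refine ⟨min r r', lt_min hr hr', fun x hx ↦ ?_⟩
      rcases hx with hx | hx
      · exact hP _ _ _ (min_le_left _ _) (hS x hx)
      · exact hP _ _ _ (min_le_right _ _) (hT x hx)
    · intro x _
      obtain ⟨r, hr, hx⟩ := h x
      exact ⟨_, nhdsWithin_le_nhds hx, r, hr, fun y hy ↦ hy⟩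
  simpa using this

/-! ### Inverse branches of local diffeomorphisms. -/

section InverseBranch

variable {n : ℕ} {M : Type*}

section

variable [TopologicalSpace M] [ChartedSpace (EuclideanSpace ℝ (Fin n)) M] {f : M → M} {p₀ p : M}

theorem mfderiv_localInverse_comp [IsManifold (𝓡 n) 1 M]
    (hf : IsLocalDiffeomorph (𝓡 n) (𝓡 n) 1 f) (hp : p ∈ (hf p₀).localInverse.target) :
    (mfderiv (𝓡 n) (𝓡 n) (hf p₀).localInverse (f p) : EuclideanSpace ℝ (Fin n) →L[ℝ] _) ∘L
      (mfderiv (𝓡 n) (𝓡 n) f p : EuclideanSpace ℝ (Fin n) →L[ℝ] EuclideanSpace ℝ (Fin n)) =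
      ContinuousLinearMap.id ℝ (EuclideanSpace ℝ (Fin n)) ∧
    (mfderiv (𝓡 n) (𝓡 n) f p : EuclideanSpace ℝ (Fin n) →L[ℝ] EuclideanSpace ℝ (Fin n)) ∘L
      (mfderiv (𝓡 n) (𝓡 n) (hf p₀).localInverse (f p) : EuclideanSpace ℝ (Fin n) →L[ℝ] _) =
      ContinuousLinearMap.id ℝ (EuclideanSpace ℝ (Fin n)) := by
  set h := (hf p₀).localInverse with hh
  have hhp : h (f p) = p := (hf p₀).localInverse_left_inv hp
  have hsrc : f p ∈ h.source := by
    have := h.map_target hp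
    have h2 := (hf p₀).localInverse_right_inv this
    change f (h (h.invFun p)) = h.invFun p at h2
    rw [show h (h.invFun p) = p from h.right_inv hp] at h2
    rw [h2]
    exact this
  have hhd : MDifferentiableAt (𝓡 n) (𝓡 n) h (f p) :=
    h.mdifferentiableAt one_ne_zero hsrc
  have hfd : MDifferentiableAt (𝓡 n) (𝓡 n) f p := (hf p).mdifferentiableAt one_ne_zero
  constructor
  · have h1 : mfderiv (𝓡 n) (𝓡 n) (h ∘ f) p =
        (mfderiv (𝓡 n) (𝓡 n) h (f p)) ∘L (mfderiv (𝓡 n) (𝓡 n) f p) := mfderiv_comp p hhd hfd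
    refine h1.symm.trans ?_
    have : h ∘ f =ᶠ[𝓝 p] id := Filter.eventuallyEq_of_mem (h.open_target.mem_nhds hp)
      (hf p₀).localInverse_eqOn_left
    rw [this.mfderiv_eq]
    exact mfderiv_id
  · have hfd' : MDifferentiableAt (𝓡 n) (𝓡 n) f (h (f p)) := by rwa [hhp]
    have h1 : mfderiv (𝓡 n) (𝓡 n) (f ∘ h) (f p) =
        (mfderiv (𝓡 n) (𝓡 n) f (h (f p))) ∘L (mfderiv (𝓡 n) (𝓡 n) h (f p)) :=
      mfderiv_comp (f p) hfd' hhd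
    have h2 : (mfderiv (𝓡 n) (𝓡 n) f (h (f p)) : EuclideanSpace ℝ (Fin n) →L[ℝ]
        EuclideanSpace ℝ (Fin n)) = mfderiv (𝓡 n) (𝓡 n) f p := by rw [hhp]
    rw [← h2]
    refine h1.symm.trans ?_
    have : f ∘ h =ᶠ[𝓝 (f p)] id := Filter.eventuallyEq_of_mem (h.open_source.mem_nhds hsrc)
      (hf p₀).localInverse_eqOn_right
    rw [this.mfderiv_eq]
    exact mfderiv_id

variable [RiemannianBundle (fun x : M ↦ TangentSpace (𝓡 n) x)]

/-- The operator norm of a linear map of the model space, seen as a map between tangent spaces. -/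
noncomputable def normAt (x y : M)
    (L : EuclideanSpace ℝ (Fin n) →L[ℝ] EuclideanSpace ℝ (Fin n)) : ℝ :=
  ‖(show TangentSpace (𝓡 n) x →L[ℝ] TangentSpace (𝓡 n) y from L)‖

/-- Turns inverses taken point by point into the derivative of a single `C^1` map, to which the
continuity and Lipschitz results above apply near `f p₀`. -/
theorem normInvDeriv_eq_norm_mfderiv_localInverse [IsManifold (𝓡 n) 1 M]
    (hf : IsLocalDiffeomorph (𝓡 n) (𝓡 n) 1 f) (hp : p ∈ (hf p₀).localInverse.target) :
    normInvDeriv n f p = ‖mfderiv (𝓡 n) (𝓡 n) (hf p₀).localInverse (f p)‖ := by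
  have hhp : (hf p₀).localInverse (f p) = p := (hf p₀).localInverse_left_inv hp
  have h1 : (mfderiv (𝓡 n) (𝓡 n) f p : EuclideanSpace ℝ (Fin n) →L[ℝ]
      EuclideanSpace ℝ (Fin n)).inverse = mfderiv (𝓡 n) (𝓡 n) (hf p₀).localInverse (f p) :=
    ContinuousLinearMap.inverse_eq (mfderiv_localInverse_comp hf hp).2
      (mfderiv_localInverse_comp hf hp).1
  -- `normAt` separates the linear map from its fibres, so the base point `(hf p₀).localInverse (f
  -- p)` can be rewritten to `p`.
  change normAt (f p) p (mfderiv (𝓡 n) (𝓡 n) f p : EuclideanSpace ℝ (Fin n) →L[ℝ]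
      EuclideanSpace ℝ (Fin n)).inverse =
    normAt (f p) ((hf p₀).localInverse (f p)) (mfderiv (𝓡 n) (𝓡 n) (hf p₀).localInverse (f p))
  rw [h1, hhp]

theorem normInvDeriv_pos [IsManifold (𝓡 n) 1 M] (hn : n ≠ 0)
    (hf : IsLocalDiffeomorph (𝓡 n) (𝓡 n) 1 f) (p : M) : 0 < normInvDeriv n f p := by
  have hp := (hf p).localInverse_mem_target
  have hn' : NeZero n := ⟨hn⟩
  rw [normInvDeriv_eq_norm_mfderiv_localInverse hf hp]
  refine (ContinuousLinearMap.opNorm_nonneg _).lt_of_ne' fun h0 ↦ ?_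
  have aux : ∀ A B : EuclideanSpace ℝ (Fin n) →L[ℝ] EuclideanSpace ℝ (Fin n),
      A ∘L B = ContinuousLinearMap.id ℝ _ → ∀ v, B v = 0 → v = 0 := fun A B hAB v hv ↦ by
    simpa [hv] using congr($hAB.symm v)
  have h3 : (mfderiv (𝓡 n) (𝓡 n) (hf p).localInverse (f p) : EuclideanSpace ℝ (Fin n) →L[ℝ] _)
    (EuclideanSpace.single (0 : Fin n) (1 : ℝ)) = 0 := by
    have h5 := (mfderiv (𝓡 n) (𝓡 n) (hf p).localInverse (f p)).le_opNorm
      (EuclideanSpace.single (0 : Fin n) (1 : ℝ))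
    rw [h0, zero_mul] at h5
    exact norm_le_zero_iff.1 h5
  have h2 := aux _ _ (mfderiv_localInverse_comp hf hp).2 _ h3
  have h4 := congr($h2 0)
  simp at h4

end

variable [EMetricSpace M] [ChartedSpace (EuclideanSpace ℝ (Fin n)) M]
  [RiemannianBundle (fun x : M ↦ TangentSpace (𝓡 n) x)] [IsManifold (𝓡 n) 1 M]
  [IsContinuousRiemannianBundle (EuclideanSpace ℝ (Fin n)) (fun x : M ↦ TangentSpace (𝓡 n) x)]
  [IsRiemannianManifold (𝓡 n) M] {f : M → M}

/-- One factor `exp (ε / 2)` pays for the Lipschitz bound of the local inverse near `f p₀`, the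
other for replacing `normInvDeriv n f p₀` by its value at `p`. -/
theorem eventually_hasInverseBranchBound (hn : n ≠ 0)
    (hf : IsLocalDiffeomorph (𝓡 n) (𝓡 n) 1 f) {ε : ℝ} (hε : 0 < ε) (p₀ : M) :
    ∃ r > 0, ∀ᶠ p in 𝓝 p₀,
      HasInverseBranchBound f p (Real.exp ε * normInvDeriv n f p) (ENNReal.ofReal r) := by
  set h := (hf p₀).localInverse with hh
  have hp₀ := (hf p₀).localInverse_mem_target
  have hq₀ := (hf p₀).localInverse_mem_source
  have hpos := normInvDeriv_pos hn hf p₀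
  have hcont : ContMDiffAt (𝓡 n) (𝓡 n) 1 h (f p₀) := (hf p₀).localInverse_contMDiffAt
  have hfc : Continuous f := hf.contMDiff.continuous
  have hε2 : 1 < Real.exp (ε / 2) := Real.one_lt_exp_iff.2 (by positivity)
  have heq : normInvDeriv n f p₀ = ‖mfderiv (𝓡 n) (𝓡 n) h (f p₀)‖ :=
    normInvDeriv_eq_norm_mfderiv_localInverse hf hp₀
  obtain ⟨V, hV, hVL⟩ := exists_nhds_riemannianEDist_le hcont
    (K := Real.exp (ε / 2) * normInvDeriv n f p₀) (by rw [← heq]; nlinarith)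
  have hlow : ∀ᶠ p in 𝓝 p₀,
      Real.exp (ε / 2) * normInvDeriv n f p₀ ≤ Real.exp ε * normInvDeriv n f p := by
    have h1 := (tendsto_norm_mfderiv hcont).comp (hfc.tendsto p₀)
    rw [← heq] at h1
    filter_upwards [h1.eventually (eventually_gt_nhds
      (show (Real.exp (ε / 2))⁻¹ * normInvDeriv n f p₀ < _ from
        mul_lt_of_lt_one_left hpos (inv_lt_one_of_one_lt₀ hε2))),
      h.open_target.mem_nhds hp₀] with p hp hpt
    rw [normInvDeriv_eq_norm_mfderiv_localInverse hf hpt]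
    rw [inv_mul_lt_iff₀ (by positivity)] at hp
    have : Real.exp ε = Real.exp (ε / 2) * Real.exp (ε / 2) := by
      rw [← Real.exp_add]; ring_nf
    rw [this, mul_assoc]
    gcongr
    exact hp.le
  have hV' : V ∩ h.source ∈ 𝓝 (f p₀) := inter_mem hV (h.open_source.mem_nhds hq₀)
  have hU : f ⁻¹' (V ∩ h.source) ∩ h.target ∈ 𝓝 p₀ :=
    inter_mem (hfc.continuousAt.preimage_mem_nhds hV') (h.open_target.mem_nhds hp₀)
  obtain ⟨r₁, hr₁, hr₁V⟩ := EMetric.mem_nhds_iff.1 hV'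
  obtain ⟨r₂, hr₂, hr₂U⟩ := EMetric.mem_nhds_iff.1 hU
  obtain ⟨r, hr0, hr⟩ := ENNReal.lt_iff_exists_real_btwn.1
    (show 0 < min (r₁ / 2) (r₂ / 2) from
      lt_min (ENNReal.half_pos hr₁.ne') (ENNReal.half_pos hr₂.ne'))
  have hrpos : 0 < ENNReal.ofReal r := hr.1
  refine ⟨r, ENNReal.ofReal_pos.1 hrpos, ?_⟩
  have hball : ∀ {x y z : M} {s : ℝ≥0∞}, ENNReal.ofReal r < s / 2 → edist x y < ENNReal.ofReal r →
      edist y z < ENNReal.ofReal r → x ∈ Metric.eball z s := by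
    intro x y z s hs hxy hyz
    calc edist x z ≤ edist x y + edist y z := edist_triangle _ _ _
      _ < s / 2 + s / 2 := ENNReal.add_lt_add (hxy.trans hs) (hyz.trans hs)
      _ = s := ENNReal.add_halves s
  have hself : ∀ x : M, edist x x < ENNReal.ofReal r := fun x ↦ by simpa using hrpos
  filter_upwards [hlow, Metric.eball_mem_nhds p₀ hrpos,
    hfc.continuousAt.preimage_mem_nhds (Metric.eball_mem_nhds (f p₀) hrpos)] with p hp hpb hfpb
  have hpU := hr₂U (hball (hr.2.trans_le (min_le_right _ _)) (hself p) hpb)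
  have hhp : h (f p) = p := (hf p₀).localInverse_left_inv hpU.2
  refine ⟨fun y hy ↦ ?_, fun q hq ↦ ?_⟩
  · have hyU := hr₂U (hball (hr.2.trans_le (min_le_right _ _)) hy hpb)
    have h1 := hVL (f y) hyU.1.1 (f p) hpU.1.1
    rw [hhp, (hf p₀).localInverse_left_inv hyU.2, ← IsRiemannianManifold.out (I := 𝓡 n),
      ← IsRiemannianManifold.out (I := 𝓡 n)] at h1
    exact h1.trans (by gcongr)
  · have hqV := hr₁V (hball (hr.2.trans_le (min_le_left _ _)) hq hfpb)
    refine ⟨h q, (hf p₀).localInverse_right_inv hqV.2, ?_⟩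
    have h1 := hVL q hqV.1 (f p) hpU.1.1
    rw [hhp, ← IsRiemannianManifold.out (I := 𝓡 n), ← IsRiemannianManifold.out (I := 𝓡 n)] at h1
    exact h1.trans (by gcongr)

theorem exists_forall_hasInverseBranchBound [CompactSpace M] (hn : n ≠ 0) {d : ℕ}
    {f : Fin d → M → M} (hf : ∀ i, IsLocalDiffeomorph (𝓡 n) (𝓡 n) 1 (f i)) {ε : ℝ} (hε : 0 < ε) :
    ∃ r > 0, ∀ i p, HasInverseBranchBound (f i) p (Real.exp ε * normInvDeriv n (f i) p)
      (ENNReal.ofReal r) := by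
  have h1 : ∀ i, ∃ r > 0, ∀ p, HasInverseBranchBound (f i) p
      (Real.exp ε * normInvDeriv n (f i) p) (ENNReal.ofReal r) := fun i ↦
    exists_pos_forall_of_compactSpace
      (fun _ _ _ hr h ↦ h.mono le_rfl (ENNReal.ofReal_le_ofReal hr))
      (eventually_hasInverseBranchBound hn (hf i) hε)
  -- The finite discrete space `Fin d` is compact, so the same lemma makes the scale uniform in `i`.
  obtain ⟨r, hr, hr'⟩ := exists_pos_forall_of_compactSpace (X := Fin d)
    (P := fun i r ↦ ∀ p, HasInverseBranchBound (f i) p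
      (Real.exp ε * normInvDeriv n (f i) p) (ENNReal.ofReal r))
    (fun _ _ _ hr h p ↦ (h p).mono le_rfl (ENNReal.ofReal_le_ofReal hr))
    (fun i ↦ by simpa using h1 i)
  exact ⟨r, hr, hr'⟩

end InverseBranch

/-! ### The Riemannian density in charts. -/

section Gram

variable {n : ℕ} {M : Type*} [TopologicalSpace M] [ChartedSpace (EuclideanSpace ℝ (Fin n)) M]
  [RiemannianBundle (fun x : M ↦ TangentSpace (𝓡 n) x)]

/-- The inner product of two vectors of the model space, seen as tangent vectors at `x`. -/
noncomputable def innerAt (x : M) (v w : EuclideanSpace ℝ (Fin n)) : ℝ :=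
  inner ℝ (show TangentSpace (𝓡 n) x from v) (show TangentSpace (𝓡 n) x from w)

theorem innerAt_sum_sum (x : M) (a b : Fin n → ℝ) (v w : Fin n → EuclideanSpace ℝ (Fin n)) :
    innerAt x (∑ i, a i • v i) (∑ j, b j • w j) = ∑ i, ∑ j, a i * b j * innerAt x (v i) (w j) := by
  have h1 : innerAt x (∑ i, a i • v i) (∑ j, b j • w j) =
      inner ℝ (∑ i, a i • (show TangentSpace (𝓡 n) x from v i))
        (∑ j, b j • (show TangentSpace (𝓡 n) x from w j)) := rfl
  rw [h1, sum_inner]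
  refine Finset.sum_congr rfl fun i _ ↦ ?_
  rw [inner_sum]
  refine Finset.sum_congr rfl fun j _ ↦ ?_
  rw [real_inner_smul_left, real_inner_smul_right, ← mul_assoc]
  rfl

theorem gramMatrix_apply (p : M) (y : EuclideanSpace ℝ (Fin n)) (i j : Fin n) :
    gramMatrix n p y i j = innerAt ((chartAt (EuclideanSpace ℝ (Fin n)) p).symm y)
      (coordVector n p y i) (coordVector n p y j) := rfl

theorem gramMatrix_det_pos [IsManifold (𝓡 n) 1 M] (p : M) {y : EuclideanSpace ℝ (Fin n)}
    (hy : y ∈ (chartAt (EuclideanSpace ℝ (Fin n)) p).target) : 0 < (gramMatrix n p y).det := by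
  have h1 := (mdifferentiable_chart (I := 𝓡 n) p).comp_symm_deriv hy
  have hinj : Function.Injective
      (mfderiv (𝓡 n) (𝓡 n) (chartAt (EuclideanSpace ℝ (Fin n)) p).symm y) := by
    intro v w hvw
    have h2 := congr($h1 v)
    have h3 := congr($h1 w)
    have h4 : (mfderiv (𝓡 n) (𝓡 n) (chartAt (EuclideanSpace ℝ (Fin n)) p)
        ((chartAt (EuclideanSpace ℝ (Fin n)) p).symm y)).comp
        (mfderiv (𝓡 n) (𝓡 n) (chartAt (EuclideanSpace ℝ (Fin n)) p).symm y) v =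
        (mfderiv (𝓡 n) (𝓡 n) (chartAt (EuclideanSpace ℝ (Fin n)) p)
        ((chartAt (EuclideanSpace ℝ (Fin n)) p).symm y)).comp
        (mfderiv (𝓡 n) (𝓡 n) (chartAt (EuclideanSpace ℝ (Fin n)) p).symm y) w :=
      congrArg (mfderiv (𝓡 n) (𝓡 n) (chartAt (EuclideanSpace ℝ (Fin n)) p)
        ((chartAt (EuclideanSpace ℝ (Fin n)) p).symm y)) hvw
    exact h2.symm.trans (h4.trans h3)
  have hlin : LinearIndependent ℝ (fun i : Fin n ↦ coordVector n p y i) := by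
    have hb := (EuclideanSpace.basisFun (Fin n) ℝ).toBasis.linearIndependent
    have := hb.map' (mfderiv (𝓡 n) (𝓡 n)
      (chartAt (EuclideanSpace ℝ (Fin n)) p).symm y).toLinearMap (LinearMap.ker_eq_bot.2 hinj)
    convert! this using 1
    ext1 i
    simp [coordVector]
    rfl
  exact (Matrix.posDef_gram_of_linearIndependent (𝕜 := ℝ) hlin).det_pos

/-- The inverse chart is used as a `C^2` map, because its derivative has to give `C^1` coordinate
fields. -/
theorem contDiffOn_gramMatrix [IsManifold (𝓡 n) ∞ M]
    [IsContMDiffRiemannianBundle (𝓡 n) ∞ (EuclideanSpace ℝ (Fin n))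
      (fun x : M ↦ TangentSpace (𝓡 n) x)] (p : M) (i j : Fin n) :
    ContDiffOn ℝ 1 (fun y ↦ gramMatrix n p y i j)
      (chartAt (EuclideanSpace ℝ (Fin n)) p).target := by
  set φ := chartAt (EuclideanSpace ℝ (Fin n)) p with hφ
  have hsymm : ContMDiffOn (𝓡 n) (𝓡 n) 2 φ.symm φ.target :=
    contMDiffOn_chart_symm (I := 𝓡 n) (n := 2)
  have hsec : ∀ k : Fin n, ContMDiffOn (𝓡 n) (𝓡 n).tangent 1
      (fun y ↦ (⟨φ.symm y, coordVector n p y k⟩ : TangentBundle (𝓡 n) M)) φ.target := by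
    intro k
    have h1 := hsymm.contMDiffOn_tangentMapWithin (m := 1) (by norm_num)
      φ.open_target.uniqueMDiffOn
    have h2 : ContMDiff (𝓡 n) (𝓡 n).tangent 1
        (fun y ↦ (⟨y, EuclideanSpace.single k (1 : ℝ)⟩ :
          TangentBundle (𝓡 n) (EuclideanSpace ℝ (Fin n)))) :=
      contMDiff_vectorSpace_iff_contDiff.2 contDiff_const
    have h3 := h1.comp (t := Bundle.TotalSpace.proj ⁻¹' φ.target) h2.contMDiffOn
      (fun y hy ↦ hy : φ.target ⊆ _)
    refine h3.congr fun y hy ↦ ?_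
    simp only [Function.comp, tangentMapWithin, coordVector]
    rw [mfderivWithin_of_isOpen φ.open_target hy]
  have hbundle : IsContMDiffRiemannianBundle (𝓡 n) 1 (EuclideanSpace ℝ (Fin n))
      (fun x : M ↦ TangentSpace (𝓡 n) x) := IsContMDiffRiemannianBundle.of_le (n := ∞) (by simp)
  have := ContMDiffOn.inner_bundle (IB := 𝓡 n) (F := EuclideanSpace ℝ (Fin n))
    (E := fun x : M ↦ TangentSpace (𝓡 n) x) (hsec i) (hsec j)
  exact contMDiffOn_iff_contDiffOn.1 this

theorem contDiffAt_log_sqrt_gramMatrix_det [IsManifold (𝓡 n) ∞ M]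
    [IsContMDiffRiemannianBundle (𝓡 n) ∞ (EuclideanSpace ℝ (Fin n))
      (fun x : M ↦ TangentSpace (𝓡 n) x)] (p : M) {y : EuclideanSpace ℝ (Fin n)}
    (hy : y ∈ (chartAt (EuclideanSpace ℝ (Fin n)) p).target) :
    ContDiffAt ℝ 1 (fun y ↦ Real.log (Real.sqrt (gramMatrix n p y).det)) y := by
  have hdet : ContDiffAt ℝ 1 (fun y ↦ (gramMatrix n p y).det) y := by
    simp only [Matrix.det_apply]
    refine ContDiffAt.sum fun σ _ ↦ ContDiffAt.const_smul _ (contDiffAt_prod fun i _ ↦ ?_)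
    exact (contDiffOn_gramMatrix p (σ i) i).contDiffAt
      ((chartAt (EuclideanSpace ℝ (Fin n)) p).open_target.mem_nhds hy)
  have hpos := gramMatrix_det_pos p hy
  exact (hdet.sqrt hpos.ne').log (Real.sqrt_pos.2 hpos).ne'

/-- Transformation of the volume density under a change of charts. -/
theorem sqrt_gramMatrix_det_eq [IsManifold (𝓡 n) 1 M] (p q : M) {y : EuclideanSpace ℝ (Fin n)}
    (hy : y ∈ (chartAt (EuclideanSpace ℝ (Fin n)) p).target)
    (hq : (chartAt (EuclideanSpace ℝ (Fin n)) p).symm y ∈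
      (chartAt (EuclideanSpace ℝ (Fin n)) q).source)
    {D : EuclideanSpace ℝ (Fin n) →L[ℝ] EuclideanSpace ℝ (Fin n)}
    (hD : HasFDerivAt (chartAt (EuclideanSpace ℝ (Fin n)) q ∘
      (chartAt (EuclideanSpace ℝ (Fin n)) p).symm) D y) :
    Real.sqrt (gramMatrix n p y).det = |D.det| * Real.sqrt (gramMatrix n q
      (chartAt (EuclideanSpace ℝ (Fin n)) q
        ((chartAt (EuclideanSpace ℝ (Fin n)) p).symm y))).det := by
  set φ := chartAt (EuclideanSpace ℝ (Fin n)) p with hφ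
  set ψ := chartAt (EuclideanSpace ℝ (Fin n)) q with hψ
  set x := φ.symm y with hx
  set z := ψ x with hz
  have hψz : ψ.symm z = x := ψ.left_inv hq
  have hzt : z ∈ ψ.target := ψ.map_source hq
  have hmD : HasMFDerivAt (𝓡 n) (𝓡 n) (ψ ∘ φ.symm) y D := hasMFDerivAt_iff_hasFDerivAt.2 hD
  have hcomp : (mfderiv (𝓡 n) (𝓡 n) φ.symm y : EuclideanSpace ℝ (Fin n) →L[ℝ] _) =
      (mfderiv (𝓡 n) (𝓡 n) ψ.symm z : EuclideanSpace ℝ (Fin n) →L[ℝ] _) ∘L D := by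
    have h1 : HasMFDerivAt (𝓡 n) (𝓡 n) ψ.symm ((ψ ∘ φ.symm) y)
        (mfderiv (𝓡 n) (𝓡 n) ψ.symm z) :=
      ((mdifferentiable_chart (I := 𝓡 n) q).mdifferentiableAt_symm hzt).hasMFDerivAt
    have h2 := (h1.comp y hmD).mfderiv
    have h3 : ψ.symm ∘ ψ ∘ φ.symm =ᶠ[𝓝 y] φ.symm := by
      have hc : ContinuousAt φ.symm y := φ.continuousAt_symm hy
      filter_upwards [hc.preimage_mem_nhds (ψ.open_source.mem_nhds hq)] with t ht
      exact ψ.left_inv ht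
    rw [h3.mfderiv_eq] at h2
    exact h2
  set b := (EuclideanSpace.basisFun (Fin n) ℝ) with hb
  set Dm : Matrix (Fin n) (Fin n) ℝ := LinearMap.toMatrix b.toBasis b.toBasis D.toLinearMap with hDm
  have hcoord : ∀ i, (coordVector n p y i : EuclideanSpace ℝ (Fin n)) =
      ∑ k, Dm k i • (coordVector n q z k : EuclideanSpace ℝ (Fin n)) := by
    intro i
    have h1 : (coordVector n p y i : EuclideanSpace ℝ (Fin n)) =
        (mfderiv (𝓡 n) (𝓡 n) ψ.symm z : EuclideanSpace ℝ (Fin n) →L[ℝ] EuclideanSpace ℝ (Fin n))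
          (D (EuclideanSpace.single i 1)) :=
      congr($hcomp (EuclideanSpace.single i (1 : ℝ)))
    have h2 : D (EuclideanSpace.single i 1) =
        ∑ k, Dm k i • (EuclideanSpace.single k (1 : ℝ) : EuclideanSpace ℝ (Fin n)) := by
      have := b.toBasis.sum_repr (D (EuclideanSpace.single i 1))
      rw [← this]
      refine Finset.sum_congr rfl fun k _ ↦ ?_
      simp [hDm, LinearMap.toMatrix_apply, hb]
    rw [h1, h2]
    exact (map_sum _ _ _).trans (Finset.sum_congr rfl fun k _ ↦ map_smul _ _ _)
  have hgram : gramMatrix n p y = Dm.transpose * gramMatrix n q z * Dm := by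
    ext i j
    rw [gramMatrix_apply, hcoord i, hcoord j]
    refine (innerAt_sum_sum x (fun k ↦ Dm k i) (fun k ↦ Dm k j) (fun k ↦ coordVector n q z k)
      (fun k ↦ coordVector n q z k)).trans ?_
    rw [Matrix.mul_apply]
    simp only [Matrix.mul_apply, Matrix.transpose_apply, gramMatrix_apply, Finset.sum_mul]
    rw [Finset.sum_comm]
    refine Finset.sum_congr rfl fun k _ ↦ Finset.sum_congr rfl fun l _ ↦ ?_
    change Dm l i * Dm k j * innerAt x _ _ = Dm l i * innerAt (ψ.symm z) _ _ * Dm k j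
    rw [hψz]
    ring
  have hdet : Dm.det = D.det := LinearMap.det_toMatrix b.toBasis D.toLinearMap
  rw [hgram, Matrix.det_mul, Matrix.det_mul, Matrix.det_transpose, hdet,
    show D.det * (gramMatrix n q z).det * D.det = D.det ^ 2 * (gramMatrix n q z).det by ring,
    Real.sqrt_mul (sq_nonneg _), Real.sqrt_sq_eq_abs]

end Gram

theorem measurableSet_inter_preimage_of_continuousOn {X Y : Type*} [TopologicalSpace X]
    [MeasurableSpace X] [BorelSpace X] [TopologicalSpace Y] [MeasurableSpace Y]
    [BorelSpace Y] {g : X → Y} {s : Set X} {t : Set Y} (hs : MeasurableSet s)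
    (hg : ContinuousOn g s) (ht : MeasurableSet t) : MeasurableSet (s ∩ g ⁻¹' t) := by
  have h1 : Measurable fun x : s ↦ g x :=
    (continuousOn_iff_continuous_domRestrict.1 hg).measurable
  have h2 : s ∩ g ⁻¹' t = Subtype.val '' ((fun x : s ↦ g x) ⁻¹' t) := by
    ext x
    simp [and_comm]
  rw [h2]
  exact hs.subtype_image (h1 ht)

/-! ### The Riemannian volume and change of variables. -/

section Volume

variable {n : ℕ} {M : Type*} [TopologicalSpace M] [ChartedSpace (EuclideanSpace ℝ (Fin n)) M]
  [MeasurableSpace M] [BorelSpace M]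

theorem measurableSet_image_chartAt (p : M) {E : Set M} (hE : MeasurableSet E)
    (hEp : E ⊆ (chartAt (EuclideanSpace ℝ (Fin n)) p).source) :
    MeasurableSet (chartAt (EuclideanSpace ℝ (Fin n)) p '' E) := by
  rw [(chartAt (EuclideanSpace ℝ (Fin n)) p).image_eq_target_inter_inv_preimage hEp]
  exact measurableSet_inter_preimage_of_continuousOn
    (chartAt (EuclideanSpace ℝ (Fin n)) p).open_target.measurableSet
    (chartAt (EuclideanSpace ℝ (Fin n)) p).continuousOn_symm hE

variable [RiemannianBundle (fun x : M ↦ TangentSpace (𝓡 n) x)]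

theorem chartVolume_apply (p : M) {E : Set M} (hE : MeasurableSet E) :
    chartVolume n p E =
      ∫⁻ y in chartAt (EuclideanSpace ℝ (Fin n)) p ''
          (E ∩ (chartAt (EuclideanSpace ℝ (Fin n)) p).source),
        ENNReal.ofReal (Real.sqrt (gramMatrix n p y).det) := by
  set φ := chartAt (EuclideanSpace ℝ (Fin n)) p with hφ
  have hae : AEMeasurable φ.symm (volume.restrict φ.target) :=
    φ.continuousOn_symm.aemeasurable φ.open_target.measurableSet
  rw [chartVolume, Measure.map_apply_of_aemeasurable
    (hae.mono_ac (withDensity_absolutelyContinuous _ _)) hE, withDensity_apply',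
    Measure.restrict_restrict' φ.open_target.measurableSet,
    φ.image_eq_target_inter_inv_preimage inter_subset_right]
  congr 2
  ext y
  simp only [mem_inter_iff, mem_preimage]
  exact ⟨fun h ↦ ⟨h.2, h.1, φ.map_target h.2⟩, fun h ↦ ⟨h.2.1, h.1⟩⟩

theorem chartVolume_apply_of_subset (p : M) {E : Set M} (hE : MeasurableSet E)
    (hEp : E ⊆ (chartAt (EuclideanSpace ℝ (Fin n)) p).source) :
    chartVolume n p E = ∫⁻ y in chartAt (EuclideanSpace ℝ (Fin n)) p '' E,
        ENNReal.ofReal (Real.sqrt (gramMatrix n p y).det) := by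
  rw [chartVolume_apply p hE, inter_eq_left.2 hEp]

theorem chartVolume_inter_source (p : M) {E : Set M} (hE : MeasurableSet E) :
    chartVolume n p (E ∩ (chartAt (EuclideanSpace ℝ (Fin n)) p).source) = chartVolume n p E := by
  rw [chartVolume_apply p hE, chartVolume_apply p
    (hE.inter (chartAt (EuclideanSpace ℝ (Fin n)) p).open_source.measurableSet), inter_assoc,
    inter_self]

/-- Change of variables for a map read in two charts. -/
theorem chartVolume_image (p q : M) {f : M → M} {E : Set M} (hE : MeasurableSet E)
    (hEp : E ⊆ (chartAt (EuclideanSpace ℝ (Fin n)) p).source) (hfE : MeasurableSet (f '' E))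
    (hfq : f '' E ⊆ (chartAt (EuclideanSpace ℝ (Fin n)) q).source) (hinj : InjOn f E)
    {F' : EuclideanSpace ℝ (Fin n) → EuclideanSpace ℝ (Fin n) →L[ℝ] EuclideanSpace ℝ (Fin n)}
    (hF' : ∀ y ∈ chartAt (EuclideanSpace ℝ (Fin n)) p '' E,
      HasFDerivAt (chartAt (EuclideanSpace ℝ (Fin n)) q ∘ f ∘
        (chartAt (EuclideanSpace ℝ (Fin n)) p).symm) (F' y) y) :
    chartVolume n q (f '' E) = ∫⁻ y in chartAt (EuclideanSpace ℝ (Fin n)) p '' E,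
      ENNReal.ofReal (|(F' y).det| * Real.sqrt (gramMatrix n q
        ((chartAt (EuclideanSpace ℝ (Fin n)) q ∘ f ∘
          (chartAt (EuclideanSpace ℝ (Fin n)) p).symm) y)).det) := by
  set φ := chartAt (EuclideanSpace ℝ (Fin n)) p with hφ
  set ψ := chartAt (EuclideanSpace ℝ (Fin n)) q with hψ
  have himage : ψ '' (f '' E) = (ψ ∘ f ∘ φ.symm) '' (φ '' E) := by
    rw [image_image, image_image]
    refine image_congr fun x hx ↦ ?_
    simp [φ.left_inv (hEp hx)]
  have hinj' : InjOn (ψ ∘ f ∘ φ.symm) (φ '' E) := by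
    rintro _ ⟨x, hx, rfl⟩ _ ⟨x', hx', rfl⟩ h
    simp only [Function.comp, φ.left_inv (hEp hx), φ.left_inv (hEp hx')] at h
    rw [hinj hx hx' (ψ.injOn (hfq (mem_image_of_mem f hx)) (hfq (mem_image_of_mem f hx')) h)]
  rw [chartVolume_apply_of_subset q hfE hfq, ← hψ, himage,
    lintegral_image_eq_lintegral_abs_det_fderiv_mul volume (measurableSet_image_chartAt p hE hEp)
      (fun y hy ↦ (hF' y hy).hasFDerivWithinAt) hinj']
  refine lintegral_congr fun y ↦ ?_
  rw [ENNReal.ofReal_mul (abs_nonneg _)]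

/-- This is `chartVolume_image` for the identity; the Jacobian of the chart change cancels against
the change of density. -/
theorem chartVolume_eq_of_subset [IsManifold (𝓡 n) 1 M] (p q : M) {E : Set M}
    (hE : MeasurableSet E) (hEp : E ⊆ (chartAt (EuclideanSpace ℝ (Fin n)) p).source)
    (hEq : E ⊆ (chartAt (EuclideanSpace ℝ (Fin n)) q).source) :
    chartVolume n q E = chartVolume n p E := by
  set φ := chartAt (EuclideanSpace ℝ (Fin n)) p with hφ
  set ψ := chartAt (EuclideanSpace ℝ (Fin n)) q with hψ
  have hd : ∀ y ∈ φ '' E, HasFDerivAt (ψ ∘ φ.symm) (fderiv ℝ (ψ ∘ φ.symm) y) y := by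
    rintro _ ⟨x, hx, rfl⟩
    have hx' : φ.symm (φ x) = x := φ.left_inv (hEp hx)
    have h1 : MDifferentiableAt (𝓡 n) (𝓡 n) φ.symm (φ x) :=
      (mdifferentiable_chart (I := 𝓡 n) p).mdifferentiableAt_symm (φ.map_source (hEp hx))
    have h2 : MDifferentiableAt (𝓡 n) (𝓡 n) ψ (φ.symm (φ x)) :=
      (mdifferentiable_chart (I := 𝓡 n) q).mdifferentiableAt (hx'.symm ▸ hEq hx)
    exact (mdifferentiableAt_iff_differentiableAt.1 (h2.comp _ h1)).hasFDerivAt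
  have h := chartVolume_image (n := n) p q (f := id) hE hEp (by simpa using hE)
    (by simpa using hEq) (injOn_id E) (F' := fderiv ℝ (ψ ∘ φ.symm)) hd
  rw [image_id] at h
  rw [h, chartVolume_apply_of_subset p hE hEp]
  refine setLIntegral_congr_fun (measurableSet_image_chartAt p hE hEp) fun y hy ↦ ?_
  have hy' := hd y hy
  obtain ⟨x, hx, rfl⟩ := hy
  simp only [Function.comp, id]
  rw [sqrt_gramMatrix_det_eq p q (φ.map_source (hEp hx))
    (by rw [← hφ, φ.left_inv (hEp hx)]; exact hEq hx) hy']

/-- The Riemannian volume is given in each chart by its density. -/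
theorem riemannianVolume_apply_of_subset [IsManifold (𝓡 n) 1 M] (p : M) {E : Set M}
    (hE : MeasurableSet E) (hEp : E ⊆ (chartAt (EuclideanSpace ℝ (Fin n)) p).source) :
    riemannianVolume n M E = chartVolume n p E := by
  set S := (chartAt (EuclideanSpace ℝ (Fin n)) p).source with hS
  have hSm : MeasurableSet S := (chartAt (EuclideanSpace ℝ (Fin n)) p).open_source.measurableSet
  refine le_antisymm ?_ (Measure.le_iff'.1 (le_iSup (fun q : M ↦ chartVolume n q) p) E)
  -- The supremum is bounded by one explicit measure: infinite mass at each point off the chart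
  -- domain absorbs what other charts see there, and inside the domain the chart volumes agree.
  have hle : riemannianVolume n M ≤
      chartVolume n p + ((⊤ : ℝ≥0∞) • Measure.count).restrict Sᶜ := by
    refine iSup_le fun q ↦ Measure.le_iff.2 fun s hs ↦ ?_
    rw [Measure.add_apply, Measure.restrict_apply hs]
    by_cases hsS : (s ∩ Sᶜ).Nonempty
    · have : Measure.count (s ∩ Sᶜ) ≠ 0 := Measure.count_ne_zero hsS
      simp [this]
    · rw [not_nonempty_iff_eq_empty, ← sdiff_eq, sdiff_eq_empty] at hsS
      rw [← chartVolume_inter_source q hs, chartVolume_eq_of_subset p q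
        (hs.inter (chartAt (EuclideanSpace ℝ (Fin n)) q).open_source.measurableSet)
        (inter_subset_left.trans hsS) inter_subset_right]
      exact (measure_mono inter_subset_left).trans le_self_add
  refine (Measure.le_iff'.1 hle E).trans_eq ?_
  have hES : E ∩ Sᶜ = ∅ := by rw [← sdiff_eq, sdiff_eq_empty.2 hEp]
  rw [Measure.add_apply, Measure.restrict_apply hE, hES, measure_empty, add_zero]

theorem isLocallyFiniteMeasure_riemannianVolume [IsManifold (𝓡 n) ∞ M]
    [IsContMDiffRiemannianBundle (𝓡 n) ∞ (EuclideanSpace ℝ (Fin n))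
      (fun x : M ↦ TangentSpace (𝓡 n) x)] :
    IsLocallyFiniteMeasure (riemannianVolume n M) := by
  refine ⟨fun p ↦ ?_⟩
  set φ := chartAt (EuclideanSpace ℝ (Fin n)) p with hφ
  have hp : p ∈ φ.source := mem_chart_source _ p
  have hpt : φ p ∈ φ.target := φ.map_source hp
  have hcont : ContinuousAt (fun y ↦ (gramMatrix n p y).det) (φ p) := by
    simp only [Matrix.det_apply]
    refine tendsto_finsetSum _ fun σ _ ↦ Tendsto.const_smul (tendsto_finsetProd _ fun i _ ↦ ?_) _
    exact ((contDiffOn_gramMatrix p (σ i) i).contDiffAt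
      (φ.open_target.mem_nhds hpt)).continuousAt
  obtain ⟨r, hr, hrs⟩ := Metric.mem_nhds_iff.1 (inter_mem (φ.open_target.mem_nhds hpt)
    (hcont.sqrt.eventually (eventually_lt_nhds (lt_add_one _))))
  have hopen : IsOpen (φ.source ∩ φ ⁻¹' Metric.ball (φ p) r) :=
    φ.isOpen_inter_preimage Metric.isOpen_ball
  refine ⟨_, hopen.mem_nhds ⟨hp, Metric.mem_ball_self hr⟩, ?_⟩
  rw [riemannianVolume_apply_of_subset p hopen.measurableSet inter_subset_left,
    chartVolume_apply_of_subset p hopen.measurableSet inter_subset_left]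
  have hsub : φ '' (φ.source ∩ φ ⁻¹' Metric.ball (φ p) r) ⊆ Metric.ball (φ p) r := by
    rintro _ ⟨x, hx, rfl⟩
    exact hx.2
  calc _ ≤ ∫⁻ y in Metric.ball (φ p) r, ENNReal.ofReal (Real.sqrt (gramMatrix n p y).det) :=
        lintegral_mono_set hsub
    _ ≤ ∫⁻ _ in Metric.ball (φ p) r,
          ENNReal.ofReal (Real.sqrt (gramMatrix n p (φ p)).det + 1) :=
        setLIntegral_mono' measurableSet_ball fun y hy ↦
          ENNReal.ofReal_le_ofReal (le_of_lt (hrs hy).2)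
    _ < ⊤ := by
        rw [setLIntegral_const]
        exact ENNReal.mul_lt_top ENNReal.ofReal_lt_top measure_ball_lt_top

end Volume

/-! ### Local Hölder continuity. -/

section Holder

variable {V : Type*} [NormedAddCommGroup V]

/-- `u` is `α`-Hölder continuous on a neighbourhood of `y₀`. -/
def IsHolderNear (α : ℝ) (u : V → ℝ) (y₀ : V) : Prop :=
  ∃ C ≥ 0, ∃ t ∈ 𝓝 y₀, ∀ y ∈ t, ∀ y' ∈ t, |u y - u y'| ≤ C * dist y y' ^ α

variable {α : ℝ} {u v : V → ℝ} {y₀ : V}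

theorem IsHolderNear.add (hu : IsHolderNear α u y₀) (hv : IsHolderNear α v y₀) :
    IsHolderNear α (fun y ↦ u y + v y) y₀ := by
  obtain ⟨C, hC, t, ht, h⟩ := hu
  obtain ⟨C', hC', t', ht', h'⟩ := hv
  refine ⟨C + C', add_nonneg hC hC', t ∩ t', inter_mem ht ht', fun y hy y' hy' ↦ ?_⟩
  calc |u y + v y - (u y' + v y')| = |(u y - u y') + (v y - v y')| := by ring_nf
    _ ≤ |u y - u y'| + |v y - v y'| := abs_add_le _ _
    _ ≤ (C + C') * dist y y' ^ α := by
        rw [add_mul]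
        exact add_le_add (h y hy.1 y' hy'.1) (h' y hy.2 y' hy'.2)

theorem IsHolderNear.neg (hu : IsHolderNear α u y₀) : IsHolderNear α (fun y ↦ -u y) y₀ := by
  obtain ⟨C, hC, t, ht, h⟩ := hu
  refine ⟨C, hC, t, ht, fun y hy y' hy' ↦ ?_⟩
  rw [show -u y - -u y' = -(u y - u y') by ring, abs_neg]
  exact h y hy y' hy'

/-- A `C^1` function is locally Lipschitz, and on a ball of radius `1 / 2` distances are at most
`1`, hence at most their power `α ≤ 1`. -/
theorem isHolderNear_of_contDiffAt [NormedSpace ℝ V] (hα1 : α ≤ 1)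
    (hu : ContDiffAt ℝ 1 u y₀) : IsHolderNear α u y₀ := by
  obtain ⟨K, t, ht, hK⟩ := hu.exists_lipschitzOnWith
  refine ⟨K, K.2, t ∩ Metric.ball y₀ (1 / 2), inter_mem ht (Metric.ball_mem_nhds _ (by norm_num)),
    fun y hy y' hy' ↦ ?_⟩
  have h1 := hK.dist_le_mul y hy.1 y' hy'.1
  rw [Real.dist_eq] at h1
  refine h1.trans ?_
  gcongr
  refine Real.self_le_rpow_of_le_one dist_nonneg ?_ hα1
  have h2 : dist y y₀ < 1 / 2 := hy.2
  have h3 : dist y' y₀ < 1 / 2 := hy'.2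
  linarith [dist_triangle_right y y' y₀]

theorem isHolderNear_comp_of_holderOnWith {W : Type*} [NormedAddCommGroup W] [NormedSpace ℝ W]
    {g : W → ℝ} {A : V → W} {U : Set V} (hU : U ∈ 𝓝 y₀) {C β : ℝ≥0} (hA : HolderOnWith C β A U)
    (hAc : ContinuousAt A y₀) (hg : ContDiffAt ℝ 1 g (A y₀)) :
    IsHolderNear β (fun y ↦ g (A y)) y₀ := by
  obtain ⟨K, t, ht, hK⟩ := hg.exists_lipschitzOnWith
  refine ⟨K * C, by positivity, U ∩ A ⁻¹' t, inter_mem hU (hAc.preimage_mem_nhds ht),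
    fun y hy y' hy' ↦ ?_⟩
  have h1 := hK.dist_le_mul _ hy.2 _ hy'.2
  rw [Real.dist_eq] at h1
  refine h1.trans ?_
  rw [mul_assoc]
  gcongr
  exact hA.dist_le hy.1 hy'.1

end Holder

theorem contDiff_continuousLinearMap_det (n : ℕ) :
    ContDiff ℝ 1 (fun A : EuclideanSpace ℝ (Fin n) →L[ℝ] EuclideanSpace ℝ (Fin n) ↦ A.det) := by
  set b := (EuclideanSpace.basisFun (Fin n) ℝ).toBasis with hb
  have h1 : ∀ A : EuclideanSpace ℝ (Fin n) →L[ℝ] EuclideanSpace ℝ (Fin n),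
      A.det = (Matrix.of fun i j ↦ (EuclideanSpace.proj (𝕜 := ℝ) i)
        (A (EuclideanSpace.single j 1))).det := by
    intro A
    have h2 : A.det = (LinearMap.toMatrix b b A.toLinearMap).det :=
      (LinearMap.det_toMatrix b A.toLinearMap).symm
    rw [h2]
    congr 1
  simp only [h1, Matrix.det_apply]
  refine ContDiff.sum fun σ _ ↦ ContDiff.const_smul _ (contDiff_prod fun i _ ↦ ?_)
  simp only [Matrix.of_apply]
  fun_prop

/-! ### Distortion from the oscillation of the log-Jacobian. -/

section Density

variable {X Y : Type*} [MeasurableSpace X] [MeasurableSpace Y] {m : Measure X}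
  {μ : Measure Y}

/-- A map whose Jacobian, read in charts, has small oscillation has small distortion. -/
theorem hasDistortionOn_of_lintegral {T : X → X} {φ : X → Y} {S : Set X} {ρ u : Y → ℝ}
    (hφ : ∀ E ⊆ S, MeasurableSet E → MeasurableSet (φ '' E))
    (hT : ∀ E ⊆ S, MeasurableSet E → MeasurableSet (T '' E))
    (hρ : ∀ y ∈ φ '' S, 0 ≤ ρ y)
    (hm : ∀ E ⊆ S, MeasurableSet E → m E = ∫⁻ y in φ '' E, ENNReal.ofReal (ρ y) ∂μ)
    (hmT : ∀ E ⊆ S, MeasurableSet E →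
      m (T '' E) = ∫⁻ y in φ '' E, ENNReal.ofReal (Real.exp (u y) * ρ y) ∂μ)
    {u₀ κ : ℝ} (hu : ∀ y ∈ φ '' S, |u y - u₀| ≤ κ) : HasDistortionOn m T S κ := by
  -- The constant `J` is the Jacobian at a reference point.
  refine ⟨ENNReal.ofReal (Real.exp u₀), by simp [Real.exp_pos], ENNReal.ofReal_ne_top,
    fun E hE hEm ↦ ⟨hT E hE hEm, ?_, ?_⟩⟩
  · rw [hm E hE hEm, hmT E hE hEm, ← mul_assoc, ← ENNReal.ofReal_mul (Real.exp_pos _).le,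
      ← Real.exp_add, ← lintegral_const_mul' _ _ ENNReal.ofReal_ne_top]
    refine setLIntegral_mono' (hφ E hE hEm) fun y hy ↦ ?_
    rw [← ENNReal.ofReal_mul (Real.exp_pos _).le]
    have h1 := (abs_le.1 (hu y (image_mono hE hy))).2
    have h2 := hρ y (image_mono hE hy)
    gcongr
    linarith
  · rw [hm E hE hEm, hmT E hE hEm, ← lintegral_const_mul' _ _ ENNReal.ofReal_ne_top,
      ← lintegral_const_mul' _ _ ENNReal.ofReal_ne_top]
    refine setLIntegral_mono' (hφ E hE hEm) fun y hy ↦ ?_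
    rw [← ENNReal.ofReal_mul (Real.exp_pos _).le, ← ENNReal.ofReal_mul (Real.exp_pos _).le,
      ← mul_assoc, ← Real.exp_add]
    have h1 := (abs_le.1 (hu y (image_mono hE hy))).1
    have h2 := hρ y (image_mono hE hy)
    gcongr
    linarith

end Density

section LocalDiffeo

variable {n : ℕ} {M : Type*} [TopologicalSpace M] [ChartedSpace (EuclideanSpace ℝ (Fin n)) M] {f : M → M}

theorem contDiffAt_chartAt_comp (hf : IsLocalDiffeomorph (𝓡 n) (𝓡 n) 1 f) (p : M) :
    ContDiffAt ℝ 1 (chartAt (EuclideanSpace ℝ (Fin n)) (f p) ∘ f ∘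
      (chartAt (EuclideanSpace ℝ (Fin n)) p).symm) (chartAt (EuclideanSpace ℝ (Fin n)) p p) := by
  have h := (contMDiffAt_iff.1 (hf.contMDiff p)).2
  simpa [mfld_simps, contDiffWithinAt_univ] using h

theorem det_fderiv_chartAt_comp_ne_zero [IsManifold (𝓡 n) 1 M]
    (hf : IsLocalDiffeomorph (𝓡 n) (𝓡 n) 1 f) (p : M) :
    (fderiv ℝ (chartAt (EuclideanSpace ℝ (Fin n)) (f p) ∘ f ∘
      (chartAt (EuclideanSpace ℝ (Fin n)) p).symm)
        (chartAt (EuclideanSpace ℝ (Fin n)) p p)).det ≠ 0 := by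
  have h1 := (mfderiv_localInverse_comp hf (hf p).localInverse_mem_target).1
  have h2 : (mfderiv (𝓡 n) (𝓡 n) f p : EuclideanSpace ℝ (Fin n) →L[ℝ] EuclideanSpace ℝ (Fin n)) =
      fderiv ℝ (chartAt (EuclideanSpace ℝ (Fin n)) (f p) ∘ f ∘
      (chartAt (EuclideanSpace ℝ (Fin n)) p).symm) (chartAt (EuclideanSpace ℝ (Fin n)) p p) := by
    have hd : MDifferentiableAt (𝓡 n) (𝓡 n) f p := (hf p).mdifferentiableAt one_ne_zero
    rw [hd.mfderiv]
    simp [mfld_simps, writtenInExtChartAt, fderivWithin_univ]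
    rfl
  rw [h2] at h1
  have aux : ∀ A B : EuclideanSpace ℝ (Fin n) →L[ℝ] EuclideanSpace ℝ (Fin n),
      A ∘L B = ContinuousLinearMap.id ℝ _ → B.det ≠ 0 := by
    intro A B hAB h0
    have h3 : LinearMap.det (A.toLinearMap ∘ₗ B.toLinearMap) = 1 := by
      have : A.toLinearMap ∘ₗ B.toLinearMap = LinearMap.id := by
        rw [← ContinuousLinearMap.toLinearMap_comp, hAB]
        rfl
      rw [this, LinearMap.det_id]
    rw [LinearMap.det_comp] at h3
    have h4 : LinearMap.det B.toLinearMap = 0 := h0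
    rw [h4, mul_zero] at h3
    exact zero_ne_one h3
  exact aux _ _ h1

end LocalDiffeo

/-! ### Distortion of `C^{1+α}` local diffeomorphisms on small balls. -/

section DistortionOfMaps

variable {n : ℕ} {M : Type*} [EMetricSpace M] [ChartedSpace (EuclideanSpace ℝ (Fin n)) M]
  [IsManifold (𝓡 n) ∞ M] [RiemannianBundle (fun x : M ↦ TangentSpace (𝓡 n) x)]

theorem exists_nhds_dist_chartAt_le
    [IsContinuousRiemannianBundle (EuclideanSpace ℝ (Fin n)) (fun x : M ↦ TangentSpace (𝓡 n) x)]
    [IsRiemannianManifold (𝓡 n) M] (p : M) :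
    ∃ L > 0, ∃ V ∈ 𝓝 p, ∀ x ∈ V, ∀ x' ∈ V,
      edist (chartAt (EuclideanSpace ℝ (Fin n)) p x) (chartAt (EuclideanSpace ℝ (Fin n)) p x') ≤
        ENNReal.ofReal L * edist x x' := by
  have h1 : ContMDiffAt (𝓡 n) (𝓡 n) 1 (chartAt (EuclideanSpace ℝ (Fin n)) p) p :=
    (contMDiffOn_chart (I := 𝓡 n) (n := 1)).contMDiffAt (chart_source_mem_nhds _ p)
  have hbundle : IsContinuousRiemannianBundle (EuclideanSpace ℝ (Fin n))
      (fun x : EuclideanSpace ℝ (Fin n) ↦ TangentSpace (𝓡 n) x) :=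
    ⟨(riemannianMetricVectorSpace (EuclideanSpace ℝ (Fin n))).inner,
      (riemannianMetricVectorSpace (EuclideanSpace ℝ (Fin n))).contMDiff.continuous,
      fun _ _ _ ↦ rfl⟩
  obtain ⟨K, hK⟩ := exists_gt ‖mfderiv (𝓡 n) (𝓡 n) (chartAt (EuclideanSpace ℝ (Fin n)) p) p‖
  obtain ⟨V, hV, hVL⟩ := exists_nhds_riemannianEDist_le h1 hK
  refine ⟨K, (ContinuousLinearMap.opNorm_nonneg _).trans_lt hK, V, hV, fun x hx x' hx' ↦ ?_⟩
  rw [IsRiemannianManifold.out (I := 𝓡 n) x x', IsRiemannianManifold.out (I := 𝓡 n)]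
  exact hVL x hx x' hx'

variable [IsContMDiffRiemannianBundle (𝓡 n) ∞ (EuclideanSpace ℝ (Fin n))
      (fun x : M ↦ TangentSpace (𝓡 n) x)]
  [IsRiemannianManifold (𝓡 n) M] [MeasurableSpace M] [BorelSpace M] {α : ℝ≥0} {f : M → M}

/-- The Hölder constant is written as `r⁻¹`, so that one parameter bounds both scale and constant.
Shrinking `r` weakens the statement, as `exists_pos_forall_of_compactSpace` requires. -/
theorem eventually_hasDistortionOn_eball (hα : 0 < α) (hα1 : α ≤ 1)
    (hf : IsC1HolderLocalDiffeo n α f) (p₀ : M) :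
    ∃ r > 0, ∀ᶠ p in 𝓝 p₀, ∀ s, 0 < s → s ≤ r →
      HasDistortionOn (riemannianVolume n M) f (Metric.eball p (ENNReal.ofReal s))
        (r⁻¹ * s ^ (α : ℝ)) := by
  have hbundle : IsContinuousRiemannianBundle (EuclideanSpace ℝ (Fin n))
    (fun x : M ↦ TangentSpace (𝓡 n) x) := isContinuousRiemannianBundle_of_contMDiff (k := ∞)
  have hfd := hf.isLocalDiffeomorph
  have hfc : Continuous f := hfd.contMDiff.continuous
  set φ := chartAt (EuclideanSpace ℝ (Fin n)) p₀ with hφ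
  set ψ := chartAt (EuclideanSpace ℝ (Fin n)) (f p₀) with hψ
  set F := ψ ∘ f ∘ φ.symm with hF
  set h := (hfd p₀).localInverse with hh
  have hφp : p₀ ∈ φ.source := mem_chart_source _ p₀
  have hψp : f p₀ ∈ ψ.source := mem_chart_source _ (f p₀)
  have hFp : F (φ p₀) = ψ (f p₀) := by simp [hF, φ.left_inv hφp]
  have hFc : ContDiffAt ℝ 1 F (φ p₀) := contDiffAt_chartAt_comp hfd p₀
  have hdet : (fderiv ℝ F (φ p₀)).det ≠ 0 := det_fderiv_chartAt_comp_ne_zero hfd p₀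
  have hF'c : ContinuousAt (fderiv ℝ F) (φ p₀) :=
    (hFc.fderiv_right (m := 0) (by simp)).continuousAt
  -- the logarithm of the Jacobian is Hölder continuous
  set u : EuclideanSpace ℝ (Fin n) → ℝ := fun y ↦ (Real.log ((fderiv ℝ F y).det) +
    Real.log (Real.sqrt (gramMatrix n (f p₀) (F y)).det)) +
      -Real.log (Real.sqrt (gramMatrix n p₀ y).det) with hu
  have hα1' : (α : ℝ) ≤ 1 := by exact_mod_cast hα1
  have hα' : 0 < (α : ℝ) := by exact_mod_cast hα
  have huH : IsHolderNear α u (φ p₀) := by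
    refine IsHolderNear.add (IsHolderNear.add ?_ ?_) (IsHolderNear.neg ?_)
    · obtain ⟨U, hU, C, hC⟩ := hf.holder p₀
      exact isHolderNear_comp_of_holderOnWith (g := fun A ↦ Real.log A.det) hU hC hF'c
        ((contDiff_continuousLinearMap_det n).contDiffAt.log hdet)
    · refine isHolderNear_of_contDiffAt hα1' ?_
      refine ContDiffAt.comp (φ p₀) (g := fun z ↦ Real.log (Real.sqrt (gramMatrix n (f p₀) z).det))
        ?_ hFc
      rw [hFp]
      exact contDiffAt_log_sqrt_gramMatrix_det (f p₀) (ψ.map_source hψp)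
    · exact isHolderNear_of_contDiffAt hα1'
        (contDiffAt_log_sqrt_gramMatrix_det p₀ (φ.map_source hφp))
  obtain ⟨C, hC, t, ht, hCt⟩ := huH
  obtain ⟨L, hL, V, hV, hVL⟩ := exists_nhds_dist_chartAt_le (n := n) p₀
  -- a neighbourhood on which everything is controlled
  have hev1 : ∀ᶠ y in 𝓝 (φ p₀), y ∈ t ∧ DifferentiableAt ℝ F y ∧ (fderiv ℝ F y).det ≠ 0 := by
    refine (eventually_mem_set.2 ht).and (Eventually.and ?_ ?_)
    · filter_upwards [hFc.eventually (by simp)] with y hy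
      exact hy.differentiableAt one_ne_zero
    · exact ((contDiff_continuousLinearMap_det n).continuous.continuousAt.comp hF'c).eventually_ne
        hdet
  have hO : ∀ᶠ x in 𝓝 p₀, (φ x ∈ t ∧ DifferentiableAt ℝ F (φ x) ∧ (fderiv ℝ F (φ x)).det ≠ 0) ∧
      x ∈ φ.source ∧ f x ∈ ψ.source ∧ x ∈ h.target ∧ x ∈ V := by
    filter_upwards [(φ.continuousAt hφp).eventually hev1, φ.open_source.mem_nhds hφp,
      hfc.continuousAt.preimage_mem_nhds (ψ.open_source.mem_nhds hψp),
      h.open_target.mem_nhds (hfd p₀).localInverse_mem_target, hV] with x h1 h2 h3 h4 h5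
    exact ⟨h1, h2, h3, h4, h5⟩
  obtain ⟨R, hR, hRO⟩ := EMetric.mem_nhds_iff.1 hO
  obtain ⟨r, hr0, hr⟩ := ENNReal.lt_iff_exists_real_btwn.1 (ENNReal.half_pos hR.ne')
  have hrpos : 0 < r := ENNReal.ofReal_pos.1 hr.1
  set D := C * L ^ (α : ℝ) with hD
  have hD0 : 0 ≤ D := by positivity
  refine ⟨min r (D + 1)⁻¹, lt_min hrpos (by positivity), ?_⟩
  filter_upwards [Metric.eball_mem_nhds p₀ hr.1] with p hp s hs hsr
  have hball : ∀ x ∈ Metric.eball p (ENNReal.ofReal s), x ∈ Metric.eball p₀ R := by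
    intro x hx
    have h1 : edist x p < R / 2 := lt_of_lt_of_le hx
      ((ENNReal.ofReal_le_ofReal (hsr.trans (min_le_left _ _))).trans hr.2.le)
    calc edist x p₀ ≤ edist x p + edist p p₀ := edist_triangle _ _ _
      _ < R / 2 + R / 2 := ENNReal.add_lt_add h1 (lt_trans hp hr.2)
      _ = R := ENNReal.add_halves R
  have hS := fun x hx ↦ hRO (hball x hx)
  have hpS : p ∈ Metric.eball p (ENNReal.ofReal s) :=
    Metric.mem_eball_self (ENNReal.ofReal_pos.2 hs)
  have hDr : D ≤ (min r (D + 1)⁻¹)⁻¹ := by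
    have h1 : (D + 1) ≤ (min r (D + 1)⁻¹)⁻¹ := by
      rw [le_inv_comm₀ (by positivity) (lt_min hrpos (by positivity))]
      exact min_le_right _ _
    linarith
  have hinj : InjOn f (Metric.eball p (ENNReal.ofReal s)) := by
    intro x hx x' hx' hxx'
    rw [← (hfd p₀).localInverse_left_inv (hS x hx).2.2.2.1,
      ← (hfd p₀).localInverse_left_inv (hS x' hx').2.2.2.1, hxx']
  have hfm : ∀ E ⊆ Metric.eball p (ENNReal.ofReal s), MeasurableSet E → MeasurableSet (f '' E) := by
    intro E hE hEm
    -- Forward images are preimages under the continuous local inverse, hence measurable.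
    have h1 : f '' E = h.source ∩ h ⁻¹' E := by
      ext q
      constructor
      · rintro ⟨x, hx, rfl⟩
        have hxt := (hS x (hE hx)).2.2.2.1
        have hfx : h (f x) = x := (hfd p₀).localInverse_left_inv hxt
        refine ⟨?_, by rw [mem_preimage, hfx]; exact hx⟩
        have h2 := h.map_target hxt
        have h3 := (hfd p₀).localInverse_right_inv h2
        change f (h (h.invFun x)) = h.invFun x at h3
        rw [show h (h.invFun x) = x from h.right_inv hxt] at h3
        rw [h3]
        exact h2
      · rintro ⟨hq, hqE⟩
        exact ⟨h q, hqE, (hfd p₀).localInverse_right_inv hq⟩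
    rw [h1]
    exact measurableSet_inter_preimage_of_continuousOn h.open_source.measurableSet
      h.contMDiffOn.continuousOn hEm
  refine HasDistortionOn.mono (κ := D * s ^ (α : ℝ)) ?_ (by gcongr)
  refine hasDistortionOn_of_lintegral (φ := φ) (μ := volume)
    (ρ := fun y ↦ Real.sqrt (gramMatrix n p₀ y).det) (u := u) (u₀ := u (φ p))
    (fun E hE hEm ↦ measurableSet_image_chartAt p₀ hEm fun x hx ↦ (hS x (hE hx)).2.1) hfm
    (fun y _ ↦ Real.sqrt_nonneg _) (fun E hE hEm ↦ ?_) (fun E hE hEm ↦ ?_) ?_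
  · have hEφ : E ⊆ φ.source := fun x hx ↦ (hS x (hE hx)).2.1
    rw [riemannianVolume_apply_of_subset p₀ hEm hEφ, chartVolume_apply_of_subset p₀ hEm hEφ]
  · have hEφ : E ⊆ φ.source := fun x hx ↦ (hS x (hE hx)).2.1
    have hEψ : f '' E ⊆ ψ.source := by
      rintro _ ⟨x, hx, rfl⟩
      exact (hS x (hE hx)).2.2.1
    rw [riemannianVolume_apply_of_subset (f p₀) (hfm E hE hEm) hEψ,
      chartVolume_image p₀ (f p₀) hEm hEφ (hfm E hE hEm) hEψ (hinj.mono hE)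
        (F' := fderiv ℝ F) (by
          rintro _ ⟨x, hx, rfl⟩
          exact (hS x (hE hx)).1.2.1.hasFDerivAt)]
    refine setLIntegral_congr_fun (measurableSet_image_chartAt p₀ hEm hEφ) ?_
    rintro _ ⟨x, hx, rfl⟩
    have hx' := hS x (hE hx)
    have h1 : 0 < (gramMatrix n p₀ (φ x)).det := gramMatrix_det_pos p₀ (φ.map_source hx'.2.1)
    have h2 : 0 < (gramMatrix n (f p₀) (F (φ x))).det := by
      refine gramMatrix_det_pos (f p₀) ?_
      simp only [hF, Function.comp, φ.left_inv hx'.2.1]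
      exact ψ.map_source hx'.2.2.1
    simp only [hu]
    -- `Real.log` is even, so `u` contains the logarithm of the absolute value of the determinant,
    -- whatever its sign.
    rw [Real.exp_add, Real.exp_add, Real.exp_neg, Real.exp_log (Real.sqrt_pos.2 h1),
      Real.exp_log (Real.sqrt_pos.2 h2), ← Real.log_abs, Real.exp_log (abs_pos.2 hx'.1.2.2),
      inv_mul_cancel_right₀ (Real.sqrt_pos.2 h1).ne']
  · rintro _ ⟨x, hx, rfl⟩
    have hx' := hS x hx
    have hp' := hS p hpS
    refine (hCt _ hx'.1.1 _ hp'.1.1).trans ?_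
    rw [hD, mul_assoc, ← Real.mul_rpow hL.le hs.le]
    gcongr
    have h1 := hVL x hx'.2.2.2.2 p hp'.2.2.2.2
    have h2 : edist (φ x) (φ p) ≤ ENNReal.ofReal (L * s) := by
      rw [ENNReal.ofReal_mul hL.le]
      exact h1.trans (by gcongr; exact le_of_lt hx)
    rwa [edist_le_ofReal (by positivity)] at h2

theorem exists_forall_hasDistortionOn_eball [CompactSpace M] {d : ℕ} {f : Fin d → M → M}
    (hα : 0 < α) (hα1 : α ≤ 1) (hf : ∀ i, IsC1HolderLocalDiffeo n α (f i)) :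
    ∃ C ≥ 0, ∃ r > 0, ∀ i p s, 0 < s → s ≤ r →
      HasDistortionOn (riemannianVolume n M) (f i) (Metric.eball p (ENNReal.ofReal s))
        (C * s ^ (α : ℝ)) := by
  have hmono : ∀ (g : M → M) (p : M) (r r' : ℝ), r' ≤ r →
      (∀ s, 0 < s → s ≤ r → HasDistortionOn (riemannianVolume n M) g
        (Metric.eball p (ENNReal.ofReal s)) (r⁻¹ * s ^ (α : ℝ))) →
      ∀ s, 0 < s → s ≤ r' → HasDistortionOn (riemannianVolume n M) g
        (Metric.eball p (ENNReal.ofReal s)) (r'⁻¹ * s ^ (α : ℝ)) := by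
    intro g p r r' hr h s hs hs'
    have hr' : 0 < r' := hs.trans_le hs'
    refine (h s hs (hs'.trans hr)).mono ?_
    gcongr
  have h1 : ∀ i, ∃ r > 0, ∀ p s, 0 < s → s ≤ r → HasDistortionOn (riemannianVolume n M) (f i)
      (Metric.eball p (ENNReal.ofReal s)) (r⁻¹ * s ^ (α : ℝ)) := fun i ↦
    exists_pos_forall_of_compactSpace (hmono (f i))
      (eventually_hasDistortionOn_eball hα hα1 (hf i))
  obtain ⟨r, hr, h⟩ := exists_pos_forall_of_compactSpace (X := Fin d)
    (P := fun i r ↦ ∀ p s, 0 < s → s ≤ r → HasDistortionOn (riemannianVolume n M) (f i)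
      (Metric.eball p (ENNReal.ofReal s)) (r⁻¹ * s ^ (α : ℝ)))
    (fun i r r' hr h p ↦ hmono (f i) p r r' hr (h p)) (fun i ↦ by simpa using h1 i)
  exact ⟨r⁻¹, by positivity, r, hr, h⟩

end DistortionOfMaps

/-! ### From an open set to full measure. -/

section Conclusion

theorem HasDistortionOn.smul_measure {X : Type*} [MeasurableSpace X] {m : Measure X} {T : X → X}
    {S : Set X} {κ : ℝ} (h : HasDistortionOn m T S κ) (c : ℝ≥0∞) :
    HasDistortionOn (c • m) T S κ := by
  obtain ⟨J, h0, h1, H⟩ := h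
  refine ⟨J, h0, h1, fun E hE hEm ↦ ?_⟩
  obtain ⟨a1, a2, a3⟩ := H E hE hEm
  simp only [Measure.smul_apply, smul_eq_mul]
  refine ⟨a1, ?_, ?_⟩
  · calc c * m (T '' E) ≤ c * (ENNReal.ofReal (Real.exp κ) * (J * m E)) := by gcongr
      _ = _ := by ring
  · calc J * (c * m E) = c * (J * m E) := by ring
      _ ≤ c * (ENNReal.ofReal (Real.exp κ) * m (T '' E)) := by gcongr
      _ = _ := by ring

/-- A map with local distortion bounds sends null sets to null sets. -/
theorem measure_image_eq_zero_of_hasDistortionOn {X : Type*} [EMetricSpace X] [CompactSpace X]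
    [MeasurableSpace X] [BorelSpace X] {m : Measure X} {T : X → X} {s : ℝ≥0∞} (hs : 0 < s) {κ : ℝ}
    (hT : ∀ p, HasDistortionOn m T (Metric.eball p s) κ) {E : Set X} (hE : m E = 0) :
    m (T '' E) = 0 := by
  obtain ⟨t, -, ht⟩ := isCompact_univ.elim_nhds_subcover (fun x : X ↦ Metric.eball x s)
    fun x _ ↦ Metric.eball_mem_nhds x hs
  have h1 : T '' E ⊆ ⋃ p ∈ t, T '' (E ∩ Metric.eball p s) := by
    rintro _ ⟨x, hx, rfl⟩
    obtain ⟨p, hpt, hp⟩ := mem_iUnion₂.1 (ht (mem_univ x))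
    exact mem_iUnion₂.2 ⟨p, hpt, mem_image_of_mem T ⟨hx, hp⟩⟩
  refine measure_mono_null h1 ((measure_biUnion_null_iff t.countable_toSet).2 fun p _ ↦ ?_)
  exact (hT p).measure_image_eq_zero Metric.isOpen_eball.measurableSet inter_subset_right
    (measure_mono_null inter_subset_left hE)

/-- Under an exact action by maps preserving null sets, an invariant set which contains a nonempty
open set modulo a null set has full measure. -/
theorem measure_compl_eq_zero_of_isExactAction {X : Type*} [TopologicalSpace X]
    [MeasurableSpace X] {m : Measure X} {d : ℕ} {f : Fin d → X → X}
    (hexact : IsExactAction m (generatedSemigroup f))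
    (hnull : ∀ i (E : Set X), m E = 0 → m (f i '' E) = 0) {A B : Set X}
    (hA : IsInvariantSet (generatedSemigroup f) A) (hB : IsOpen B) (hBne : B.Nonempty)
    (hBA : m (B \ A) = 0) : m Aᶜ = 0 := by
  have hnull' : ∀ g ∈ generatedSemigroup f, ∀ E : Set X, m E = 0 → m ((g : X → X) '' E) = 0 := by
    intro g hg
    induction hg using Subsemigroup.closure_induction with
    | mem g hg =>
      obtain ⟨i, rfl⟩ := hg
      exact hnull i
    | mul g g' _ _ ih ih' =>
      intro E hE
      have : ((g * g' : Function.End X) : X → X) '' E = (g : X → X) '' ((g' : X → X) '' E) :=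
        image_comp g g' E
      rw [this]
      exact ih _ (ih' _ hE)
  obtain ⟨g, hg, hgB⟩ := hexact B hB hBne
  -- Images of `B ∩ A` remain in `A`, so a point outside `A` is either missed by all the images of
  -- `B` or comes from the null set `B \ A`.
  refine measure_mono_null (t := (⋃ k, g k '' B)ᶜ ∪ ⋃ k, g k '' (B \ A)) (fun x hx ↦ ?_)
    (measure_union_null hgB (measure_iUnion_null fun k ↦ hnull' _ (hg k) _ hBA))
  by_cases h : x ∈ ⋃ k, g k '' B
  · obtain ⟨k, y, hy, rfl⟩ := mem_iUnion.1 h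
    refine Or.inr (mem_iUnion.2 ⟨k, y, ⟨hy, fun hyA ↦ hx ?_⟩, rfl⟩)
    exact hA (g k) (hg k) (mem_image_of_mem _ hyA)
  · exact Or.inl h

theorem normInvDeriv_eq_zero_of_dim_zero {M : Type*} [TopologicalSpace M]
    [ChartedSpace (EuclideanSpace ℝ (Fin 0)) M]
    [RiemannianBundle (fun x : M ↦ TangentSpace (𝓡 0) x)] (f : M → M) (x : M) :
    normInvDeriv 0 f x = 0 := by
  refine le_antisymm (ContinuousLinearMap.opNorm_le_bound _ le_rfl fun v ↦ ?_)
    (ContinuousLinearMap.opNorm_nonneg _)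
  have h1 : (v : EuclideanSpace ℝ (Fin 0)) = 0 := Subsingleton.elim (α := EuclideanSpace ℝ (Fin 0)) _ _
  rw [show v = 0 from h1, map_zero]
  simp

theorem isErgodicAction_lebesgue {n d : ℕ} (hn : n ≠ 0) {M : Type*} [EMetricSpace M]
    [CompactSpace M] [ChartedSpace (EuclideanSpace ℝ (Fin n)) M] [IsManifold (𝓡 n) ∞ M]
    [RiemannianBundle (fun x : M ↦ TangentSpace (𝓡 n) x)]
    [IsContMDiffRiemannianBundle (𝓡 n) ∞ (EuclideanSpace ℝ (Fin n))
      (fun x : M ↦ TangentSpace (𝓡 n) x)] [IsRiemannianManifold (𝓡 n) M]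
    [MeasurableSpace M] [BorelSpace M] {α : ℝ≥0} (hα : 0 < α) (hα1 : α ≤ 1)
    {f : Fin d → M → M} (hf : ∀ i, IsC1HolderLocalDiffeo n α (f i))
    (hexact : IsExactAction (lebesgue n M) (generatedSemigroup f))
    (hexp : IsNonUniformlyExpanding n (lebesgue n M) f) :
    IsErgodicAction (lebesgue n M) (generatedSemigroup f) := by
  intro A hAm hinv
  have hbundle : IsContinuousRiemannianBundle (EuclideanSpace ℝ (Fin n))
    (fun x : M ↦ TangentSpace (𝓡 n) x) := isContinuousRiemannianBundle_of_contMDiff (k := ∞)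
  have hlf := isLocallyFiniteMeasure_riemannianVolume (n := n) (M := M)
  have hfin : riemannianVolume n M univ ≠ ⊤ := isCompact_univ.measure_lt_top.ne
  -- When the volume vanishes, as for empty `M`, `lebesgue` is the zero measure and not a
  -- probability.
  by_cases h0 : riemannianVolume n M univ = 0
  · left
    rw [lebesgue, Measure.measure_univ_eq_zero.1 h0, smul_zero]
    simp
  have hprob : IsProbabilityMeasure (lebesgue n M) :=
    ⟨by simp [lebesgue, ENNReal.inv_mul_cancel h0 hfin]⟩
  refine or_iff_not_imp_left.2 fun hA ↦ ?_
  obtain ⟨w, hw⟩ := hexp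
  have hfd : ∀ i, IsLocalDiffeomorph (𝓡 n) (𝓡 n) 1 (f i) := fun i ↦ (hf i).isLocalDiffeomorph
  obtain ⟨C, hC, r, hr, hD⟩ := exists_forall_hasDistortionOn_eball (n := n) hα hα1 hf
  have hD' : ∀ i p s, 0 < s → s ≤ r →
      HasDistortionOn (lebesgue n M) (f i) (Metric.eball p (ENNReal.ofReal s))
        (C * s ^ (α : ℝ)) := fun i p s hs hsr ↦ (hD i p s hs hsr).smul_measure _
  have hinv' : ∀ i, MapsTo (f i) A A := fun i ↦
    mapsTo_iff_image_subset.2 (hinv (f i) (Subsemigroup.subset_closure (mem_range_self i)))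
  obtain ⟨B, hB, hBne, hBA⟩ := exists_isOpen_measure_diff_eq_zero (lebesgue n M)
    (ν := fun i p ↦ normInvDeriv n (f i) p) (fun i ↦ (hfd i).contMDiff.continuous)
    (fun i p ↦ normInvDeriv_pos hn (hfd i) p)
    (fun ε hε ↦ exists_forall_hasInverseBranchBound hn hfd hε) hC
    (by exact_mod_cast hα : (0 : ℝ) < α) ⟨r, hr, hD'⟩ hw hAm hinv' hA
  have hcompl := measure_compl_eq_zero_of_isExactAction hexact
    (fun i E hE ↦ measure_image_eq_zero_of_hasDistortionOn (ENNReal.ofReal_pos.2 hr)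
      (fun p ↦ hD' i p r hr le_rfl) hE) hinv hB hBne hBA
  exact (prob_compl_eq_zero_iff₀ hAm).1 hcompl

end Conclusion

end SemigroupErgodicity

open SemigroupErgodicity in
theorem theoremB (n d : ℕ) (M : Type*) [TopologicalSpace M] [T2Space M] [CompactSpace M]
    [ChartedSpace (EuclideanSpace ℝ (Fin n)) M] [IsManifold (𝓡 n) ∞ M]
    [RiemannianBundle (fun x : M ↦ TangentSpace (𝓡 n) x)]
    [IsContMDiffRiemannianBundle (𝓡 n) ∞ (EuclideanSpace ℝ (Fin n))
      (fun x : M ↦ TangentSpace (𝓡 n) x)]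
    [MeasurableSpace M] [BorelSpace M]
    (α : ℝ≥0) (hα : 0 < α) (hα1 : α ≤ 1)
    (f : Fin d → M → M) (hf : ∀ i, IsC1HolderLocalDiffeo n α (f i))
    (hexact : IsExactAction (lebesgue n M) (generatedSemigroup f))
    (hexp : IsNonUniformlyExpanding n (lebesgue n M) f) :
    IsErgodicAction (lebesgue n M) (generatedSemigroup f) := by
  -- In dimension `0` all derivative norms vanish and `Real.log 0 = 0`, so the limsup is `0` at
  -- every point. The expansion hypothesis then forces the measure to be zero.
  rcases eq_or_ne n 0 with rfl | hn
  · obtain ⟨w, hw⟩ := hexp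
    have hzero : lebesgue 0 M univ = 0 := by
      refine measure_mono_null (fun x _ ↦ ?_) hw
      simp [normInvDeriv_eq_zero_of_dim_zero]
    exact fun A _ _ ↦ Or.inl (measure_mono_null (subset_univ A) hzero)
  · have hbundle : IsContinuousRiemannianBundle (EuclideanSpace ℝ (Fin n))
      (fun x : M ↦ TangentSpace (𝓡 n) x) := isContinuousRiemannianBundle_of_contMDiff (k := ∞)
    -- The Riemannian distance induces the given topology and makes `IsRiemannianManifold` hold by
    -- definition.
    let _ : EMetricSpace M := .ofRiemannianMetric (𝓡 n) M
    have hriem : IsRiemannianManifold (𝓡 n) M := ⟨fun x y ↦ rfl⟩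
    exact isErgodicAction_lebesgue hn hα hα1 hf hexact hexp
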